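/- For a commutative ring $\Lambda$ whose additive group is free of finite rank, let $\zeta_\Lambda(s)=\sum_{n\ge 1}a_n n^{-s}$ be Solomon's zeta function of $\Lambda$, where $a_n$ is the (finite) number of ideals $I$ of $\Lambda$ with $[\Lambda:I]=n$. Let $\zeta_{\mathbb Z}$ be the Riemann zeta function, and for the ring of integers $R$ of a number field let $\zeta_R$ be its Dedekind zeta function. For a fusion ring with basis $\mathcal B$ let $\mathbb Z\mathcal B$ be the free abelian group on $\mathcal B$ with the commutative multiplication given below, in which $1$ is the identity. Then for the following fusion rings and for all complex $s$ with $\operatorname{Re}s>1$ (where all the series converge absolutely): * Fibonacci ($\mathcal B=\{1,b\}$, $b^2=1+b$): $\zeta_{\mathbb Z\mathcal B}(s)=\zeta_{\mathbb Z[(1+\sqrt5)/2]}(s)$, where $\mathbb Z[(1+\sqrt5)/2]$ is the ring of integers of $\mathbb Q(\sqrt5)$. * Ising ($\mathcal B=\{1,b,d\}$, $b^2=1$, $bd=d$, $d^2=1+b$): $\zeta_{\mathbb Z\mathcal B}(s)=(2^{1-2s}-2^{-s}+1)\,\zeta_{\mathbb Z}(s)\,\zeta_{\mathbb Z[\sqrt2]}(s)$,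 where $\mathbb Z[\sqrt2]$ is the ring of integers of $\mathbb Q(\sqrt2)$. * $\mathrm{Rep}(S_3)$ ($\mathcal B=\{1,b,d\}$, $b^2=1$, $bd=d$, $d^2=1+b+d$): $\zeta_{\mathbb Z\mathcal B}(s)=(2^{1-2s}-2^{-s}+1)(3^{1-2s}-3^{-s}+1)\,\zeta_{\mathbb Z}(s)^3$. * $PSU(5)_2$ ($\mathcal B=\{1,b,d\}$, $b^2=1+d$, $bd=b+d$, $d^2=1+b+d$): $\zeta_{\mathbb Z\mathcal B}(s)$ is the Dedekind zeta function of $\mathbb Q(\zeta_7)^+$, the maximal real subfield of $\mathbb Q(\zeta_7)$, whose ring of integers is $\mathbb Z[\alpha]$ with $\alpha=-\zeta_7-\zeta_7^2-\zeta_7^5-\zeta_7^6$, for every primitive seventh root of unity $\zeta_7$. * $E_6$-subfactor ($\mathcal B=\{1,b,d\}$, $b^2=1$, $bd=d$, $d^2=1+b+2d$): $\zeta_{\mathbb Z\mathcal B}(s)=(2^{1-2s}-2^{-s}+1)\,\zeta_{\mathbb Z}(s)\,\zeta_{\mathbb Z[\sqrt3]}(s)$, where $\mathbb Z[\sqrt3]$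 is the ring of integers of $\mathbb Q(\sqrt3)$. * The group ring $\mathbb ZC_3$ of the cyclic group of order $3$: $\zeta_{\mathbb ZC_3}(s)=(3^{1-2s}-3^{-s}+1)\,\zeta_{\mathbb Z}(s)\,\zeta_{\mathbb Z[\zeta_3]}(s)$, where $\mathbb Z[\zeta_3]$, with $\zeta_3$ a primitive cube root of unity, is the ring of integers of $\mathbb Q(\zeta_3)=\mathbb Q(\sqrt{-3})$. -/

import Mathlib

/-- The data of an integral fusion ring on a finite basis `ι`: non-negative integer structure
constants `N i j k` (the coefficient of `b_k` in `b_i * b_j`), the index `unit` of the identity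
and the involution `dual` on indices.  The ring is commutative, associative and unital,
`dual` extends to a ring involution, and the coefficient of the identity in `b_i * b_j` is `1`
if `j = dual i` and `0` otherwise. -/
structure FusionData (ι : Type) [Fintype ι] [DecidableEq ι] where
  N : ι → ι → ι → ℕ
  unit : ι
  dual : ι → ι
  comm : ∀ i j k, N i j k = N j i k
  assoc : ∀ i j k l, ∑ m, N i j m * N m k l = ∑ m, N j k m * N i m l
  unit_mul : ∀ i k, N unit i k = if i = k then 1 else 0
  dual_dual : ∀ i, dual (dual i) = i
  dual_mul : ∀ i j k, N (dual i) (dual j) (dual k) = N j i k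
  unit_coeff : ∀ i j, N i j unit = if j = dual i then 1 else 0

namespace FusionData

variable {ι : Type} [Fintype ι] [DecidableEq ι]

/-- The fusion ring `ℤB`: the free abelian group on the basis, an element being its family of
integer coordinates. -/
def FusionRing (_F : FusionData ι) : Type := ι → ℤ

variable (F : FusionData ι)

instance : AddCommGroup F.FusionRing := inferInstanceAs (AddCommGroup (ι → ℤ))

/-- The product of `ℤB`, the bilinear extension of `b_i * b_j = ∑ k, N i j k • b_k`. -/
instance : Mul F.FusionRing :=
  ⟨fun x y k => ∑ i, ∑ j, x i * y j * (F.N i j k : ℤ)⟩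

instance : One F.FusionRing := ⟨Pi.single F.unit 1⟩

theorem mul_apply (x y : F.FusionRing) (k : ι) :
    (x * y) k = ∑ i, ∑ j, x i * y j * (F.N i j k : ℤ) := rfl

theorem add_apply (x y : F.FusionRing) (k : ι) : (x + y) k = x k + y k := rfl

theorem mul_comm' (x y : F.FusionRing) : x * y = y * x := by
  funext k
  rw [mul_apply, mul_apply, Finset.sum_comm]
  refine Finset.sum_congr rfl fun i _ => Finset.sum_congr rfl fun j _ => ?_
  rw [F.comm j i k]
  ring

theorem mul_add' (x y z : F.FusionRing) : x * (y + z) = x * y + x * z := by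
  funext k
  simp only [mul_apply, add_apply, mul_add, add_mul, Finset.sum_add_distrib]

theorem one_mul' (x : F.FusionRing) : 1 * x = x := by
  funext k
  rw [mul_apply, Finset.sum_eq_single F.unit]
  · have h : (1 : F.FusionRing) F.unit = 1 := Pi.single_eq_same (M := fun _ : ι => ℤ) F.unit 1
    simp only [h, F.unit_mul, one_mul, Nat.cast_ite, Nat.cast_one, Nat.cast_zero, mul_ite, mul_one,
      mul_zero]
    exact (Finset.sum_ite_eq' Finset.univ k x).trans (if_pos (Finset.mem_univ k))
  · intro i _ hi
    have h : (1 : F.FusionRing) i = 0 := Pi.single_eq_of_ne (M := fun _ : ι => ℤ) hi 1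
    simp [h]
  · simp

theorem mul_assoc' (x y z : F.FusionRing) : x * y * z = x * (y * z) := by
  funext l
  have hL : (x * y * z) l = ∑ i, ∑ j, ∑ k, x i * y j * z k *
      ((∑ m, F.N i j m * F.N m k l : ℕ) : ℤ) := by
    simp only [mul_apply, Finset.sum_mul, Finset.mul_sum, Nat.cast_sum, Nat.cast_mul]
    calc _ = ∑ k, ∑ i, ∑ j, ∑ m, x i * y j * z k * ((F.N i j m : ℤ) * F.N m k l) := by
          rw [Finset.sum_comm]
          refine Finset.sum_congr rfl fun k _ => ?_
          rw [Finset.sum_comm]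
          refine Finset.sum_congr rfl fun i _ => ?_
          rw [Finset.sum_comm]
          refine Finset.sum_congr rfl fun j _ => Finset.sum_congr rfl fun m _ => ?_
          ring
      _ = _ := by
          rw [Finset.sum_comm]
          refine Finset.sum_congr rfl fun i _ => ?_
          rw [Finset.sum_comm]
  have hR : (x * (y * z)) l = ∑ i, ∑ j, ∑ k, x i * y j * z k *
      ((∑ m, F.N j k m * F.N i m l : ℕ) : ℤ) := by
    simp only [mul_apply, Finset.sum_mul, Finset.mul_sum, Nat.cast_sum, Nat.cast_mul]
    refine Finset.sum_congr rfl fun i _ => ?_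
    rw [Finset.sum_comm]
    refine Finset.sum_congr rfl fun j _ => ?_
    rw [Finset.sum_comm]
    refine Finset.sum_congr rfl fun k _ => Finset.sum_congr rfl fun m _ => ?_
    ring
  rw [hL, hR]
  simp only [F.assoc]

instance : CommRing F.FusionRing :=
  { (inferInstance : AddCommGroup F.FusionRing) with
    mul := (· * ·)
    one := 1
    mul_assoc := F.mul_assoc'
    mul_comm := F.mul_comm'
    one_mul := F.one_mul'
    mul_one := fun x => by rw [F.mul_comm', F.one_mul']
    left_distrib := F.mul_add'
    right_distrib := fun x y z => by
      rw [F.mul_comm', F.mul_add', F.mul_comm' z x, F.mul_comm' z y]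
    zero_mul := fun x => by
      funext k
      change ∑ i, ∑ j, (0 : ℤ) * x j * (F.N i j k : ℤ) = 0
      simp
    mul_zero := fun x => by
      funext k
      change ∑ i, ∑ j, x i * (0 : ℤ) * (F.N i j k : ℤ) = 0
      simp }

end FusionData

/-- The Fibonacci fusion ring: basis `1, b` with `b² = 1 + b`.  Entry `N i j` lists the
coordinates of `b_i * b_j` in the basis. -/
def fibonacci : FusionData (Fin 2) where
  N := ![![![1, 0], ![0, 1]],
         ![![0, 1], ![1, 1]]]
  unit := 0
  dual := id
  comm := by decide
  assoc := by decide
  unit_mul := by decide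
  dual_dual := by decide
  dual_mul := by decide
  unit_coeff := by decide

/-- The Ising fusion ring: basis `1, b, d` with `b² = 1`, `bd = d`, `d² = 1 + b`. -/
def ising : FusionData (Fin 3) where
  N := ![![![1, 0, 0], ![0, 1, 0], ![0, 0, 1]],
         ![![0, 1, 0], ![1, 0, 0], ![0, 0, 1]],
         ![![0, 0, 1], ![0, 0, 1], ![1, 1, 0]]]
  unit := 0
  dual := id
  comm := by decide
  assoc := by decide
  unit_mul := by decide
  dual_dual := by decide
  dual_mul := by decide
  unit_coeff := by decide

/-- The fusion ring `Rep(S₃)`: basis `1, b, d` with `b² = 1`, `bd = d`, `d² = 1 + b + d`. -/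
def repS3 : FusionData (Fin 3) where
  N := ![![![1, 0, 0], ![0, 1, 0], ![0, 0, 1]],
         ![![0, 1, 0], ![1, 0, 0], ![0, 0, 1]],
         ![![0, 0, 1], ![0, 0, 1], ![1, 1, 1]]]
  unit := 0
  dual := id
  comm := by decide
  assoc := by decide
  unit_mul := by decide
  dual_dual := by decide
  dual_mul := by decide
  unit_coeff := by decide

/-- The fusion ring `PSU(5)₂`: basis `1, b, d` with `b² = 1 + d`, `bd = b + d`,
`d² = 1 + b + d`. -/
def psu5 : FusionData (Fin 3) where
  N := ![![![1, 0, 0], ![0, 1, 0], ![0, 0, 1]],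
         ![![0, 1, 0], ![1, 0, 1], ![0, 1, 1]],
         ![![0, 0, 1], ![0, 1, 1], ![1, 1, 1]]]
  unit := 0
  dual := id
  comm := by decide
  assoc := by decide
  unit_mul := by decide
  dual_dual := by decide
  dual_mul := by decide
  unit_coeff := by decide

/-- The `E₆`-subfactor fusion ring: basis `1, b, d` with `b² = 1`, `bd = d`,
`d² = 1 + b + 2d`. -/
def e6 : FusionData (Fin 3) where
  N := ![![![1, 0, 0], ![0, 1, 0], ![0, 0, 1]],
         ![![0, 1, 0], ![1, 0, 0], ![0, 0, 1]],
         ![![0, 0, 1], ![0, 0, 1], ![1, 1, 2]]]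
  unit := 0
  dual := id
  comm := by decide
  assoc := by decide
  unit_mul := by decide
  dual_dual := by decide
  dual_mul := by decide
  unit_coeff := by decide

/-- The integral group ring of the cyclic group of order three. -/
abbrev GroupRingC3 : Type := MonoidAlgebra ℤ (Multiplicative (ZMod 3))

/-- The number of `Λ`-sublattices of `M` of index `n`. -/
noncomputable def sublatticeCount (Λ M : Type*) [CommRing Λ] [AddCommGroup M] [Module Λ M]
    (n : ℕ) : ℕ :=
  Nat.card {L : Submodule Λ M // L.toAddSubgroup.index = n}

/-- Solomon's zeta function `ζ_Λ(M; s) = ∑_{n ≥ 1} a_n n^{-s}`. -/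
noncomputable def solomonZeta (Λ M : Type*) [CommRing Λ] [AddCommGroup M] [Module Λ M]
    (s : ℂ) : ℂ :=
  LSeries (fun n => (sublatticeCount Λ M n : ℂ)) s

/-- The zeta function `ζ_Λ(s) = ζ_Λ(Λ; s)` of `Λ` is the function `f`: every index `n ≥ 1` occurs
for finitely many ideals only, and on the half-plane `Re s > 1` the Dirichlet series converges
absolutely, with sum `f s`. -/
def ZetaIs (Λ : Type*) [CommRing Λ] (f : ℂ → ℂ) : Prop :=
  (∀ n : ℕ, 1 ≤ n → {I : Ideal Λ | I.toAddSubgroup.index = n}.Finite) ∧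
  ∀ s : ℂ, 1 < s.re →
    LSeriesSummable (fun n => (sublatticeCount Λ Λ n : ℂ)) s ∧ solomonZeta Λ Λ s = f s

/-- The real quadratic field `ℚ(√d)`, as a subfield of `ℝ`. -/
noncomputable abbrev realQuadratic (d : ℕ) : IntermediateField ℚ ℝ :=
  IntermediateField.adjoin ℚ {Real.sqrt d}

instance (d : ℕ) : NumberField (realQuadratic d) where
  to_charZero := inferInstance
  to_finiteDimensional := by
    refine IntermediateField.adjoin.finiteDimensional ?_
    refine IsIntegral.of_pow (n := 2) two_pos ?_
    rw [Real.sq_sqrt (Nat.cast_nonneg d)]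
    exact isIntegral_algebraMap (R := ℚ) (A := ℝ) (x := (d : ℚ))

/-- The maximal real subfield `ℚ(ζ₇)⁺` of the seventh cyclotomic field. -/
noncomputable abbrev realCyclotomicSeven : Subfield (CyclotomicField 7 ℚ) :=
  NumberField.maximalRealSubfield (CyclotomicField 7 ℚ)

/-!
The zeta function of a ring is handled as the unordered sum of `[R : I] ^ (-s)` over all ideals
(`HasIdealZeta`).  Such a sum determines the Dirichlet series of the ideal counts, and its
convergence already makes the number of ideals of each index finite (`HasIdealZeta.zetaIs`).  It is
the Riemann zeta function for `ℤ`, and the Dedekind zeta function for a ring of integers, where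
convergence comes from the linear growth of the number of ideals of bounded norm.

The Fibonacci ring and the ring of `PSU(5)₂` are rings of integers.  Each of the other four is a
fibre product `Λ = A ×_{𝔽_p} B` in which the kernels of `A → 𝔽_p` and `B → 𝔽_p` are generated by
non-zero-divisors `ϖ` and `ϖ'`: `A` is always `ℤ`, and `B` is a quadratic ring `ℤ[ω]`.  For
`Rep(S₃)` this `B` is again a fibre product, of two copies of `ℤ` over `𝔽₃`.  So
everything follows from `HasIdealZeta.of_isFiberProduct`:
`ζ_Λ(s) = (p ^ (1 - 2 s) - p ^ (-s) + 1) ζ_A(s) ζ_B(s)`.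

To prove it, sort the ideals `I` of `Λ` by their projections `I₁ ⊆ A` and `I₂ ⊆ B`; write `n₁`, `n₂`
for the indices of these.  Since `(ϖ, 0)` and `(0, ϖ')` are in `Λ`, the ideal `I` contains
`ϖ I₁ × ϖ' I₂`, and `I₁ / ϖ I₁`, `I₂ / ϖ' I₂` are lines over `𝔽_p`
(`IsPrincipalResidue.exists_residueCoordinate`).  By Goursat's lemma `I` corresponds to the whole
plane or to one of the `p - 1` graphs of isomorphisms between the lines
(`IsFiberProduct.eq_comap_inf_comap_or_graphIdeal`).
* If `I₁` and `I₂` lie in the kernels, all `p` choices are ideals of `Λ`, one of index `n₁ n₂ / p`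
  and `p - 1` of index `n₁ n₂`.
* If neither lies in the kernel, only one graph is contained in `Λ`, and its index is `n₁ n₂`.
* Other pairs do not occur.

The ideals of `A` inside the kernel are the `ϖ I`, and they contribute `p ^ (-s) ζ_A(s)`; likewise
for `B`.  Hence the factor is `(1 - p ^ (-s)) ^ 2 + (p ^ s + p - 1) p ^ (-2 s)`.
-/

/-! ### Zeta functions as sums over ideals -/

/-- The zeta function of `R`, written as the unordered sum of `[R : I] ^ (-s)` over all ideals `I`,
is `f s` for `Re s > 1`.  An ideal of infinite index has index `0` in Mathlib's convention and
contributes `0 ^ (-s) = 0`. -/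
def HasIdealZeta (R : Type*) [CommRing R] (f : ℂ → ℂ) : Prop :=
  ∀ s : ℂ, 1 < s.re →
    HasSum (fun I : Ideal R => (I.toAddSubgroup.index : ℂ) ^ (-s)) (f s)

theorem neg_ne_zero_of_one_lt_re {s : ℂ} (hs : 1 < s.re) : -s ≠ 0 := by
  intro h
  rw [neg_eq_zero] at h
  rw [h, Complex.zero_re] at hs
  linarith

/-- The absolute value of `n ^ (-s)` depends only on `Re s`, also for `n = 0`. -/
theorem norm_natCast_cpow_neg (n : ℕ) {s : ℂ} (hs : 1 < s.re) :
    ‖(n : ℂ) ^ (-s)‖ = ‖(n : ℂ) ^ (-(s.re : ℂ))‖ := by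
  rcases Nat.eq_zero_or_pos n with rfl | hn
  · rw [Nat.cast_zero, Complex.zero_cpow (neg_ne_zero_of_one_lt_re hs), Complex.zero_cpow]
    exact neg_ne_zero_of_one_lt_re (by simpa using hs)
  · rw [Complex.norm_natCast_cpow_of_pos hn, Complex.norm_natCast_cpow_of_pos hn]
    simp

/-- The contribution of the objects of size `n` to a sum of `N x ^ (-s)` is the `n`-th term of the
`L`-series of the counting function. -/
theorem hasSum_fiber_term {X : Type*} (N : X → ℕ) {s : ℂ} (hs : 1 < s.re) (n : ℕ)
    (hfin : n ≠ 0 → {x | N x = n}.Finite) :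
    HasSum (fun x : {x // N x = n} => (N x : ℂ) ^ (-s))
      (LSeries.term (fun n => (Nat.card {x // N x = n} : ℂ)) s n) := by
  rcases eq_or_ne n 0 with rfl | hn
  · rw [LSeries.term_zero]
    convert! hasSum_zero using 2 with x
    rw [x.2, Nat.cast_zero, Complex.zero_cpow (neg_ne_zero_of_one_lt_re hs)]
  · have : Finite {x // N x = n} := hfin hn
    have := Fintype.ofFinite {x // N x = n}
    convert! hasSum_fintype (fun x : {x // N x = n} => (N x : ℂ) ^ (-s)) using 1
    rw [LSeries.term_of_ne_zero hn, Finset.sum_congr rfl (fun x _ => by rw [x.2]),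
      Finset.sum_const, nsmul_eq_mul, Finset.card_univ, Nat.card_eq_fintype_card,
      Complex.cpow_neg, div_eq_mul_inv]

/-- In a summable family of `N x ^ (-s)` every positive size occurs finitely often. -/
theorem finite_fiber_of_summable {X : Type*} {N : X → ℕ} {s : ℂ}
    (h : Summable fun x => (N x : ℂ) ^ (-s)) {n : ℕ} (hn : n ≠ 0) : {x | N x = n}.Finite := by
  by_contra hinf
  have : Infinite {x // N x = n} := Set.infinite_coe_iff.mpr hinf
  have h1 := h.subtype {x | N x = n}
  have h2 : Summable fun _ : {x // N x = n} => (n : ℂ) ^ (-s) := by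
    refine h1.congr fun x => ?_
    obtain ⟨x, rfl⟩ := x
    rfl
  rw [summable_const_iff, Complex.cpow_eq_zero_iff] at h2
  exact hn (by exact_mod_cast h2.1)

theorem LSeriesHasSum_of_hasSum {X : Type*} {N : X → ℕ} {s z : ℂ} (hs : 1 < s.re)
    (h : HasSum (fun x => (N x : ℂ) ^ (-s)) z) :
    LSeriesHasSum (fun n => (Nat.card {x // N x = n} : ℂ)) s z := by
  have h1 := (Equiv.sigmaFiberEquiv N).hasSum_iff.mpr h
  exact h1.sigma fun n => hasSum_fiber_term N hs n (finite_fiber_of_summable h.summable)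

theorem hasSum_of_LSeriesSummable {X : Type*} {N : X → ℕ}
    (hfin : ∀ n ≠ 0, {x | N x = n}.Finite)
    (h : ∀ s : ℂ, 1 < s.re → LSeriesSummable (fun n => (Nat.card {x // N x = n} : ℂ)) s)
    {s : ℂ} (hs : 1 < s.re) :
    HasSum (fun x => (N x : ℂ) ^ (-s)) (LSeries (fun n => (Nat.card {x // N x = n} : ℂ)) s) := by
  have hsum : Summable fun x => (N x : ℂ) ^ (-s) := by
    refine Summable.of_norm ?_
    rw [← (Equiv.sigmaFiberEquiv N).summable_iff]
    refine (summable_sigma_of_nonneg fun _ => norm_nonneg _).mpr ⟨fun n => ?_, ?_⟩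
    · exact (hasSum_fiber_term N hs n (hfin n)).summable.norm
    · have hs' : 1 < (s.re : ℂ).re := by simpa using hs
      refine (h s.re hs').norm.congr fun n => ?_
      rcases eq_or_ne n 0 with rfl | hn
      · rw [LSeries.term_zero, norm_zero]
        symm
        convert! tsum_zero using 3 with x
        simp only [Equiv.sigmaFiberEquiv_apply]
        rw [x.2, Nat.cast_zero, Complex.zero_cpow (neg_ne_zero_of_one_lt_re hs), norm_zero]
      · have : Finite {x // N x = n} := hfin n hn
        have := Fintype.ofFinite {x // N x = n}
        rw [tsum_fintype, Finset.sum_congr rfl (g := fun _ => ‖(n : ℂ) ^ (-s)‖)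
          (fun x _ => by simp only [Equiv.sigmaFiberEquiv_apply]; rw [x.2]),
          Finset.sum_const, nsmul_eq_mul, Finset.card_univ, LSeries.term_of_ne_zero hn,
          Nat.card_eq_fintype_card, norm_div, norm_natCast_cpow_neg n hs, Complex.cpow_neg,
          norm_inv, div_eq_mul_inv]
        simp
  have h2 := LSeriesHasSum_of_hasSum hs hsum.hasSum
  rw [h2.LSeries_eq]
  exact hsum.hasSum

theorem HasIdealZeta.zetaIs {R : Type*} [CommRing R] {f : ℂ → ℂ} (h : HasIdealZeta R f) :
    ZetaIs R f := by
  refine ⟨fun n hn => ?_, fun s hs => ?_⟩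
  · exact finite_fiber_of_summable (h 2 (by norm_num)).summable (by omega)
  · have := LSeriesHasSum_of_hasSum hs (h s hs)
    exact ⟨this.LSeriesSummable, this.LSeries_eq⟩

theorem HasIdealZeta.congr {R : Type*} [CommRing R] {f g : ℂ → ℂ} (h : HasIdealZeta R f)
    (hfg : ∀ s : ℂ, f s = g s) : HasIdealZeta R g := fun s hs => hfg s ▸ h s hs

theorem Ideal.index_comap_ringEquiv {R S : Type*} [CommRing R] [CommRing S] (e : R ≃+* S)
    (I : Ideal S) :
    (I.comap (e : R →+* S)).toAddSubgroup.index = I.toAddSubgroup.index :=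
  AddSubgroup.index_comap_of_surjective I.toAddSubgroup (f := (e : R →+* S).toAddMonoidHom)
    e.surjective

theorem HasIdealZeta.of_ringEquiv {R S : Type*} [CommRing R] [CommRing S] {f : ℂ → ℂ}
    (h : HasIdealZeta S f) (e : R ≃+* S) : HasIdealZeta R f := by
  intro s hs
  rw [← e.idealComapOrderIso.toEquiv.hasSum_iff]
  refine (h s hs).congr_fun ?_
  intro I
  simp only [Function.comp_apply]
  rw [← Ideal.index_comap_ringEquiv e I]
  rfl

theorem Ideal.index_toAddSubgroup_eq_absNorm {R : Type*} [CommRing R] [IsDedekindDomain R]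
    [Module.Free ℤ R] (I : Ideal R) : I.toAddSubgroup.index = Ideal.absNorm I := by
  rw [Ideal.absNorm_apply]
  rfl

theorem hasIdealZeta_int : HasIdealZeta ℤ riemannZeta := by
  intro s hs
  have h1 : HasSum (fun n : ℕ => (n : ℂ) ^ (-s)) (riemannZeta s) := by
    rw [zeta_eq_tsum_one_div_nat_cpow hs]
    refine ((Complex.summable_one_div_nat_cpow.mpr hs).hasSum).congr_fun fun n => ?_
    rw [Complex.cpow_neg, one_div]
  let e : ℕ ≃ Ideal ℤ :=
    { toFun := fun n => Ideal.span {(n : ℤ)}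
      invFun := fun I => Ideal.absNorm I
      left_inv := fun n => by simp
      right_inv := fun I => Int.ideal_span_absNorm_eq_self I }
  rw [← e.hasSum_iff]
  refine h1.congr_fun fun n => ?_
  have : (Ideal.span {(n : ℤ)}).toAddSubgroup.index = n := by
    rw [Ideal.index_toAddSubgroup_eq_absNorm]
    simp
  simp only [Function.comp_apply]
  change ((Ideal.span {(n : ℤ)}).toAddSubgroup.index : ℂ) ^ (-s) = _
  rw [this]

open NumberField in
theorem hasIdealZeta_ringOfIntegers (K : Type*) [Field K] [NumberField K] :
    HasIdealZeta (𝓞 K) (dedekindZeta K) := by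
  intro s hs
  simp only [Ideal.index_toAddSubgroup_eq_absNorm]
  refine hasSum_of_LSeriesSummable (fun n _ => Ideal.finite_setOfPred_absNorm_eq n) ?_ hs
  intro s hs
  have hO : (fun n : ℕ => ∑ k ∈ Finset.Icc 1 n,
      (Nat.card {I : Ideal (𝓞 K) // Ideal.absNorm I = k} : ℝ)) =O[Filter.atTop]
      fun n => (n : ℝ) ^ (1 : ℝ) := by
    simp only [Real.rpow_one]
    have h0 := ((Ideal.tendsto_norm_le_div_atTop₀ K).comp tendsto_natCast_atTop_atTop)
    refine Asymptotics.isBigO_of_div_tendsto_nhds ?_ _ (h0.congr fun n ↦ ?_)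
    · filter_upwards [Filter.eventually_ne_atTop 0] with n hn h
      exact absurd h (by exact_mod_cast hn)
    simp only [Function.comp_apply, Nat.cast_le, ← Nat.cast_sum, Pi.div_apply]
    congr
    rw [← add_left_inj 1, ← Ideal.card_norm_le_eq_card_norm_le_add_one,
      show Finset.Icc 1 n = Finset.Ioc 0 n from Finset.Icc_succ_left_eq_Ioc _ _,
      show 1 = Nat.card {I : Ideal (𝓞 K) // Ideal.absNorm I = 0} by
        simp [Ideal.absNorm_eq_zero_iff],
      Finset.sum_Ioc_add_eq_sum_Icc (n.zero_le),
      ← Finset.card_preimage_eq_sum_card_image_eq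
        (fun k _ ↦ Ideal.finite_setOfPred_absNorm_eq k)]
    simp [Set.coe_eq_subtype]
  exact_mod_cast LSeriesSummable_of_sum_norm_bigO_and_nonneg hO (fun _ => Nat.cast_nonneg _)
    zero_le_one hs

/-! ### Principal residue maps -/

/-- `f : A → 𝔽_p` is a ring homomorphism whose kernel is generated by the non-zero-divisor `ϖ`. -/
structure IsPrincipalResidue {A : Type*} [CommRing A] {p : ℕ} (f : A →+* ZMod p) (ϖ : A) :
    Prop where
  eq_zero_iff : ∀ a, f a = 0 ↔ ϖ ∣ a
  eq_zero_of_mul : ∀ a, ϖ * a = 0 → a = 0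

/-- `φ` restricts on the ideal `I` to an additive surjection onto `𝔽_p`, semilinear along `f`, with
kernel `ϖ I`; that is, to a coordinate on the line `I / ϖ I`.  The values of `φ` outside `I` carry
no information. -/
structure IsResidueCoordinate {A : Type*} [CommRing A] {p : ℕ} (f : A →+* ZMod p) (ϖ : A)
    (I : Ideal A) (φ : A → ZMod p) : Prop where
  map_add : ∀ x ∈ I, ∀ y ∈ I, φ (x + y) = φ x + φ y
  map_mul : ∀ a, ∀ x ∈ I, φ (a * x) = f a * φ x
  exists_eq_one : ∃ x ∈ I, φ x = 1
  exists_mul : ∀ x ∈ I, φ x = 0 → ∃ y ∈ I, x = ϖ * y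

namespace IsPrincipalResidue

variable {A : Type*} [CommRing A] {p : ℕ} {f : A →+* ZMod p} {ϖ : A}

theorem span_mul_injective (h : IsPrincipalResidue f ϖ) :
    Function.Injective fun I : Ideal A => Ideal.span {ϖ} * I := by
  have key : ∀ I J : Ideal A, Ideal.span {ϖ} * I = Ideal.span {ϖ} * J → I ≤ J := by
    intro I J hIJ x hx
    have : ϖ * x ∈ Ideal.span {ϖ} * J :=
      hIJ ▸ Ideal.mul_mem_mul (Ideal.mem_span_singleton_self ϖ) hx
    obtain ⟨y, hy, hxy⟩ := Ideal.mem_span_singleton_mul.mp this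
    have : x - y = 0 := h.eq_zero_of_mul _ (by rw [mul_sub, hxy, sub_self])
    rwa [sub_eq_zero.mp this]
  exact fun I J hIJ => le_antisymm (key I J hIJ) (key J I hIJ.symm)

theorem mem_range_span_mul_iff (h : IsPrincipalResidue f ϖ) (I : Ideal A) :
    I ∈ Set.range (fun I : Ideal A => Ideal.span {ϖ} * I) ↔ I ≤ RingHom.ker f := by
  refine ⟨?_, fun hI => ⟨Submodule.comap (LinearMap.mulLeft A ϖ) I, ?_⟩⟩
  · rintro ⟨J, rfl⟩ x hx
    obtain ⟨y, -, rfl⟩ := Ideal.mem_span_singleton_mul.mp hx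
    exact (h.eq_zero_iff _).mpr (dvd_mul_right ϖ y)
  · ext x
    rw [Ideal.mem_span_singleton_mul]
    refine ⟨?_, fun hx => ?_⟩
    · rintro ⟨y, hy, rfl⟩
      exact hy
    · obtain ⟨y, rfl⟩ := (h.eq_zero_iff x).mp (hI hx)
      exact ⟨y, hx, rfl⟩

variable [Fact p.Prime]

theorem index_ker (f : A →+* ZMod p) : f.toAddMonoidHom.ker.index = p := by
  rw [AddSubgroup.index_ker, AddMonoidHom.range_eq_top.mpr (ZMod.ringHom_surjective f)]
  simp

theorem index_map_mulLeft (h : IsPrincipalResidue f ϖ) (I : AddSubgroup A) :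
    (I.map (AddMonoidHom.mulLeft ϖ)).index = I.index * p := by
  rw [AddSubgroup.index_map_of_injective]
  · congr 1
    rw [← index_ker f]
    congr 1
    ext x
    change (∃ y, ϖ * y = x) ↔ f x = 0
    rw [h.eq_zero_iff]
    exact ⟨fun ⟨y, hy⟩ => ⟨y, hy.symm⟩, fun ⟨y, hy⟩ => ⟨y, hy.symm⟩⟩
  · rw [injective_iff_map_eq_zero]
    exact h.eq_zero_of_mul

/-- Multiplication by `ϖ` is a bijection from the ideals of `A` onto those inside `ker f`; it
multiplies the index by `p`. -/
theorem index_span_mul (h : IsPrincipalResidue f ϖ) (I : Ideal A) :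
    (Ideal.span {ϖ} * I).toAddSubgroup.index = I.toAddSubgroup.index * p := by
  rw [← h.index_map_mulLeft]
  congr 1
  ext x
  change x ∈ Ideal.span {ϖ} * I ↔ _
  rw [Ideal.mem_span_singleton_mul]
  rfl

/-- An ideal `I` of finite index has `I / ϖ I` of order `p`, like `A / ϖ A`, so `I / ϖ I` is a line
over `𝔽_p`. -/
theorem exists_residueCoordinate (h : IsPrincipalResidue f ϖ) (I : Ideal A)
    (hI : I.toAddSubgroup.index ≠ 0) : ∃ φ, IsResidueCoordinate f ϖ I φ := by
  classical
  have hp : p.Prime := Fact.out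
  set K := I.toAddSubgroup.map (AddMonoidHom.mulLeft ϖ) with hK
  have memK : ∀ x, x ∈ K ↔ ∃ y ∈ I, ϖ * y = x := fun x => Iff.rfl
  have hKI : K ≤ I.toAddSubgroup := by
    rintro _ ⟨y, hy, rfl⟩
    exact I.mul_mem_left ϖ hy
  have hrel : K.relIndex I.toAddSubgroup = p := by
    have h1 := AddSubgroup.relIndex_mul_index hKI
    rw [h.index_map_mulLeft, mul_comm] at h1
    exact Nat.eq_of_mul_eq_mul_left (Nat.pos_of_ne_zero hI) h1
  obtain ⟨x₁, hx₁, hx₁K⟩ : ∃ x ∈ I, x ∉ K := by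
    by_contra! hcon
    exact hp.one_lt.ne' (hrel.symm.trans (AddSubgroup.relIndex_eq_one.mpr hcon))
  let M : AddSubgroup A := (Ideal.span {x₁}).toAddSubgroup ⊔ K
  have hKM : K ≤ M := le_sup_right
  have hxM : x₁ ∈ M := (le_sup_left : (Ideal.span {x₁}).toAddSubgroup ≤ M)
    (Ideal.mem_span_singleton_self x₁)
  have hMI : M ≤ I.toAddSubgroup :=
    sup_le ((Ideal.span_singleton_le_iff_mem I).mpr hx₁) hKI
  have hIM : I.toAddSubgroup ≤ M := by
    have h1 := AddSubgroup.relIndex_mul_relIndex K M I.toAddSubgroup hKM hMI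
    rw [hrel] at h1
    rcases hp.eq_one_or_self_of_dvd _ ⟨_, h1.symm⟩ with h2 | h2
    · exact absurd (AddSubgroup.relIndex_eq_one.mp h2 hxM) hx₁K
    · rw [h2] at h1
      exact AddSubgroup.relIndex_eq_one.mp
        (Nat.eq_of_mul_eq_mul_left hp.pos (h1.trans (mul_one p).symm))
  have hgen : ∀ x ∈ I, ∃ a, x - a * x₁ ∈ K := by
    intro x hx
    obtain ⟨y, hy, z, hz, rfl⟩ := AddSubgroup.mem_sup.mp (hIM hx)
    obtain ⟨a, rfl⟩ := Ideal.mem_span_singleton'.mp hy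
    exact ⟨a, by simpa using hz⟩
  -- `c x₁ ∈ ϖ I` forces `f c = 0`, since otherwise `c` is invertible modulo `ϖ`.
  have hzero : ∀ c, c * x₁ ∈ K → f c = 0 := by
    intro c hc
    by_contra hfc
    obtain ⟨d, hd⟩ := ZMod.ringHom_surjective f (f c)⁻¹
    obtain ⟨t, ht⟩ := (h.eq_zero_iff (d * c - 1)).mp (by simp [hd, hfc])
    obtain ⟨y, hy, hyc⟩ := (memK _).mp hc
    refine hx₁K ((memK _).mpr ⟨d * y - t * x₁,
      I.sub_mem (I.mul_mem_left d hy) (I.mul_mem_left t hx₁), ?_⟩)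
    linear_combination d * hyc + x₁ * ht
  let φ : A → ZMod p := fun x => if hx : ∃ a, x - a * x₁ ∈ K then f hx.choose else 0
  have hφ : ∀ x a, x - a * x₁ ∈ K → φ x = f a := by
    intro x a hxa
    have hx : ∃ a, x - a * x₁ ∈ K := ⟨a, hxa⟩
    have h1 : φ x = f hx.choose := dif_pos hx
    rw [h1, ← sub_eq_zero, ← map_sub]
    refine hzero _ ?_
    have := K.sub_mem hxa hx.choose_spec
    convert this using 1
    ring
  have hKmul : ∀ a, ∀ x ∈ K, a * x ∈ K := by
    rintro a _ ⟨y, hy, rfl⟩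
    exact ⟨a * y, I.mul_mem_left a hy, by simp; ring⟩
  refine ⟨φ, fun x hx y hy => ?_, fun a x hx => ?_, ⟨x₁, hx₁, ?_⟩, fun x hx hx0 => ?_⟩
  · obtain ⟨a, ha⟩ := hgen x hx
    obtain ⟨b, hb⟩ := hgen y hy
    rw [hφ x a ha, hφ y b hb, ← map_add]
    refine hφ _ _ ?_
    have := K.add_mem ha hb
    convert this using 1
    ring
  · obtain ⟨b, hb⟩ := hgen x hx
    rw [hφ x b hb, ← map_mul]
    refine hφ _ _ ?_
    have := hKmul a _ hb
    convert this using 1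
    ring
  · rw [hφ x₁ 1 (by simp), map_one]
  · obtain ⟨a, ha⟩ := hgen x hx
    rw [hφ x a ha, h.eq_zero_iff] at hx0
    obtain ⟨t, rfl⟩ := hx0
    obtain ⟨y, hy, hyx⟩ := (memK _).mp ha
    exact ⟨y + t * x₁, I.add_mem hy (I.mul_mem_left t hx₁), by linear_combination -hyx⟩

end IsPrincipalResidue

namespace IsResidueCoordinate

variable {A : Type*} [CommRing A] {p : ℕ} {f : A →+* ZMod p} {ϖ : A} {I : Ideal A}
  {φ : A → ZMod p}

theorem map_zero (hφ : IsResidueCoordinate f ϖ I φ) : φ 0 = 0 := by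
  simpa using hφ.map_mul 0 0 I.zero_mem

theorem map_sub (hφ : IsResidueCoordinate f ϖ I φ) {x y : A} (hx : x ∈ I) (hy : y ∈ I) :
    φ (x - y) = φ x - φ y := by
  rw [sub_eq_add_neg, hφ.map_add x hx (-y) (I.neg_mem hy), ← neg_one_mul y, hφ.map_mul _ y hy]
  simp [sub_eq_add_neg]

theorem exists_eq [Fact p.Prime] (hφ : IsResidueCoordinate f ϖ I φ) (c : ZMod p) :
    ∃ x ∈ I, φ x = c := by
  obtain ⟨x, hx, hx1⟩ := hφ.exists_eq_one
  obtain ⟨a, rfl⟩ := ZMod.ringHom_surjective f c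
  exact ⟨a * x, I.mul_mem_left a hx, by rw [hφ.map_mul a x hx, hx1, mul_one]⟩

end IsResidueCoordinate

/-! ### Ideals of a fibre product over a prime field -/

/-- `Λ` is the fibre product `A ×_{𝔽_p} B` of `f : A → 𝔽_p` and `g : B → 𝔽_p`, with projections
`α` and `β`. -/
structure IsFiberProduct {Λ A B : Type*} [CommRing Λ] [CommRing A] [CommRing B] {p : ℕ}
    (α : Λ →+* A) (β : Λ →+* B) (f : A →+* ZMod p) (g : B →+* ZMod p) : Prop where
  comm : ∀ l, f (α l) = g (β l)
  eq_zero : ∀ l, α l = 0 → β l = 0 → l = 0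
  exists_lift : ∀ a b, f a = g b → ∃ l, α l = a ∧ β l = b

namespace IsFiberProduct

variable {Λ A B : Type*} [CommRing Λ] [CommRing A] [CommRing B] {p : ℕ}
  {α : Λ →+* A} {β : Λ →+* B} {f : A →+* ZMod p} {g : B →+* ZMod p}

theorem symm (h : IsFiberProduct α β f g) : IsFiberProduct β α g f where
  comm l := (h.comm l).symm
  eq_zero l h1 h2 := h.eq_zero l h2 h1
  exists_lift b a hab := (h.exists_lift a b hab.symm).imp fun _ hl => hl.symm

theorem ext (h : IsFiberProduct α β f g) {l m : Λ} (h1 : α l = α m) (h2 : β l = β m) : l = m :=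
  sub_eq_zero.mp (h.eq_zero _ (by rw [map_sub, h1, sub_self]) (by rw [map_sub, h2, sub_self]))

theorem surjective_left (h : IsFiberProduct α β f g) : Function.Surjective α := fun a => by
  obtain ⟨b, hb⟩ := ZMod.ringHom_surjective g (f a)
  exact (h.exists_lift a b hb.symm).imp fun _ hl => hl.1

theorem surjective_right (h : IsFiberProduct α β f g) : Function.Surjective β :=
  h.symm.surjective_left

theorem mem_map_left (h : IsFiberProduct α β f g) {I : Ideal Λ} {x : A} :
    x ∈ I.map α ↔ ∃ l ∈ I, α l = x :=
  Ideal.mem_map_iff_of_surjective α h.surjective_left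

theorem mem_map_right (h : IsFiberProduct α β f g) {I : Ideal Λ} {y : B} :
    y ∈ I.map β ↔ ∃ l ∈ I, β l = y :=
  h.symm.mem_map_left

theorem map_left_comap_inf_comap (h : IsFiberProduct α β f g) {I₁ : Ideal A} {I₂ : Ideal B}
    (hI : ∀ x ∈ I₁, ∃ y ∈ I₂, f x = g y) : (I₁.comap α ⊓ I₂.comap β).map α = I₁ := by
  ext x
  rw [h.mem_map_left]
  constructor
  · rintro ⟨l, hl, rfl⟩
    exact hl.1
  · intro hx
    obtain ⟨y, hy, hxy⟩ := hI x hx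
    obtain ⟨l, rfl, rfl⟩ := h.exists_lift x y hxy
    exact ⟨l, ⟨hx, hy⟩, rfl⟩

variable [Fact p.Prime]

/-- `Λ` has index `p` in `A × B`. -/
theorem index_map_prod (h : IsFiberProduct α β f g) (I : AddSubgroup Λ) :
    (I.map (α.prod β).toAddMonoidHom).index = I.index * p := by
  rw [AddSubgroup.index_map_of_injective]
  · congr 1
    let χ : A × B →+ ZMod p :=
      f.toAddMonoidHom.comp (AddMonoidHom.fst A B) - g.toAddMonoidHom.comp (AddMonoidHom.snd A B)
    have hχ : (α.prod β).toAddMonoidHom.range = χ.ker := by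
      ext ⟨a, b⟩
      change (∃ l, (α l, β l) = (a, b)) ↔ f a - g b = 0
      rw [sub_eq_zero]
      constructor
      · rintro ⟨l, hl⟩
        obtain ⟨rfl, rfl⟩ := Prod.mk.inj hl
        exact h.comm l
      · intro hab
        obtain ⟨l, rfl, rfl⟩ := h.exists_lift a b hab
        exact ⟨l, rfl⟩
    have hs : Function.Surjective χ := fun c => by
      obtain ⟨a, ha⟩ := ZMod.ringHom_surjective f c
      exact ⟨(a, 0), by simp [χ, ha]⟩
    rw [hχ, AddSubgroup.index_ker, AddMonoidHom.range_eq_top.mpr hs]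
    simp
  · rw [injective_iff_map_eq_zero]
    intro l hl
    exact h.eq_zero l (congrArg Prod.fst hl) (congrArg Prod.snd hl)

/-- Inside the maximal ideals, `I₁ × I₂` is contained in `Λ`, where its index is the index in
`A × B` divided by `p`. -/
theorem index_comap_inf_comap (h : IsFiberProduct α β f g) {I₁ : Ideal A} {I₂ : Ideal B}
    (h₁ : I₁ ≤ RingHom.ker f) (h₂ : I₂ ≤ RingHom.ker g) :
    (I₁.comap α ⊓ I₂.comap β).toAddSubgroup.index * p =
      I₁.toAddSubgroup.index * I₂.toAddSubgroup.index := by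
  rw [← h.index_map_prod, ← AddSubgroup.index_prod]
  congr 1
  ext ⟨x, y⟩
  constructor
  · rintro ⟨l, hl, hxy⟩
    obtain ⟨rfl, rfl⟩ := Prod.mk.inj hxy
    exact hl
  · rintro ⟨hx, hy⟩
    have hx' : x ∈ I₁ := hx
    have hy' : y ∈ I₂ := hy
    obtain ⟨l, rfl, rfl⟩ := h.exists_lift x y ((h₁ hx').trans (h₂ hy').symm)
    exact ⟨l, ⟨hx', hy'⟩, rfl⟩

/-- An ideal of `Λ` which is the kernel of an `𝔽_p`-valued character of `I₁ × I₂` has index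
`p [A : I₁] [B : I₂]` in `A × B`, hence index `[A : I₁] [B : I₂]` in `Λ`. -/
theorem index_of_character (h : IsFiberProduct α β f g) {I₁ : Ideal A} {I₂ : Ideal B}
    {J : Ideal Λ} (χ : A → B → ZMod p)
    (hadd : ∀ x ∈ I₁, ∀ y ∈ I₂, ∀ x' ∈ I₁, ∀ y' ∈ I₂, χ (x + x') (y + y') = χ x y + χ x' y')
    (hsurj : ∀ c, ∃ x ∈ I₁, ∃ y ∈ I₂, χ x y = c)
    (hmem : ∀ l, l ∈ J ↔ α l ∈ I₁ ∧ β l ∈ I₂ ∧ χ (α l) (β l) = 0)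
    (hlift : ∀ x ∈ I₁, ∀ y ∈ I₂, χ x y = 0 → f x = g y) :
    J.toAddSubgroup.index = I₁.toAddSubgroup.index * I₂.toAddSubgroup.index := by
  set H : AddSubgroup (A × B) := I₁.toAddSubgroup.prod I₂.toAddSubgroup with hH
  set T := J.toAddSubgroup.map (α.prod β).toAddMonoidHom with hT
  have memT : ∀ x ∈ I₁, ∀ y ∈ I₂, (x, y) ∈ T ↔ χ x y = 0 := by
    intro x hx y hy
    constructor
    · rintro ⟨l, hl, hxy⟩
      obtain ⟨rfl, rfl⟩ := Prod.mk.inj hxy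
      exact ((hmem l).mp hl).2.2
    · intro h0
      obtain ⟨l, rfl, rfl⟩ := h.exists_lift x y (hlift x hx y hy h0)
      exact ⟨l, (hmem l).mpr ⟨hx, hy, h0⟩, rfl⟩
  have hTH : T ≤ H := by
    rintro _ ⟨l, hl, rfl⟩
    exact ⟨((hmem l).mp hl).1, ((hmem l).mp hl).2.1⟩
  let ψ : H →+ ZMod p := AddMonoidHom.mk' (fun z => χ z.1.1 z.1.2) fun z z' =>
    hadd _ z.2.1 _ z.2.2 _ z'.2.1 _ z'.2.2
  have hψ : Function.Surjective ψ := fun c => by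
    obtain ⟨x, hx, y, hy, hxy⟩ := hsurj c
    exact ⟨⟨(x, y), ⟨hx, hy⟩⟩, hxy⟩
  have hrel : T.relIndex H = p := by
    have : T.addSubgroupOf H = ψ.ker := by
      ext z
      exact memT _ z.2.1 _ z.2.2
    rw [AddSubgroup.relIndex, this, AddSubgroup.index_ker, AddMonoidHom.range_eq_top.mpr hψ]
    simp
  have h1 := AddSubgroup.relIndex_mul_index hTH
  rw [hrel, hT, h.index_map_prod, hH, AddSubgroup.index_prod, mul_comm] at h1
  exact Nat.eq_of_mul_eq_mul_right (Fact.out : p.Prime).pos h1.symm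

/-! ### The ideals with given projections -/

/-- An ideal `I` contains `(ϖ x, 0)` for every `x` in its first projection, because `(ϖ, 0) ∈ Λ`. -/
theorem mem_of_map_left_eq_mul (h : IsFiberProduct α β f g) {ϖ : A} (hf : IsPrincipalResidue f ϖ)
    {I : Ideal Λ} {x : A} (hx : x ∈ I.map α) {l : Λ} (h1 : α l = ϖ * x) (h2 : β l = 0) :
    l ∈ I := by
  obtain ⟨m, hm, rfl⟩ := h.mem_map_left.mp hx
  obtain ⟨c, hc1, hc2⟩ := h.exists_lift ϖ 0 (by rw [map_zero, hf.eq_zero_iff])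
  have : l = c * m := h.ext (by rw [h1, map_mul, hc1]) (by rw [h2, map_mul, hc2, zero_mul])
  exact this ▸ I.mul_mem_left c hm

theorem map_left_le_ker_iff (h : IsFiberProduct α β f g) (I : Ideal Λ) :
    I.map α ≤ RingHom.ker f ↔ I.map β ≤ RingHom.ker g := by
  rw [Ideal.map_le_iff_le_comap, Ideal.map_le_iff_le_comap]
  constructor
  · intro hI l hl
    have : f (α l) = 0 := hI hl
    rwa [h.comm] at this
  · intro hI l hl
    have : g (β l) = 0 := hI hl
    rwa [← h.comm] at this

theorem exists_mem_eq_of_not_le_ker {I : Ideal A} (hI : ¬ I ≤ RingHom.ker f) (c : ZMod p) :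
    ∃ x ∈ I, f x = c := by
  obtain ⟨x, hx, hfx⟩ := SetLike.not_le_iff_exists.mp hI
  have hfx : f x ≠ 0 := hfx
  obtain ⟨a, ha⟩ := ZMod.ringHom_surjective f (c / f x)
  exact ⟨a * x, I.mul_mem_left a hx, by rw [map_mul, ha, div_mul_cancel₀ c hfx]⟩

/-- If neither projection lies in the maximal ideal, then an ideal of `Λ` is determined by its
projections. -/
theorem eq_comap_inf_comap (h : IsFiberProduct α β f g) {ϖ' : B} (hg : IsPrincipalResidue g ϖ')
    {I : Ideal Λ} (hI : ¬ I.map β ≤ RingHom.ker g) :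
    I = (I.map α).comap α ⊓ (I.map β).comap β := by
  refine le_antisymm (le_inf Ideal.le_comap_map Ideal.le_comap_map) ?_
  rintro l ⟨hl1, hl2⟩
  have hl2 : β l ∈ I.map β := hl2
  obtain ⟨m, hm, hml⟩ := h.mem_map_left.mp hl1
  obtain ⟨b, hb, hge⟩ := exists_mem_eq_of_not_le_ker hI 1
  obtain ⟨e, he, rfl⟩ := h.mem_map_right.mp hb
  obtain ⟨t, ht⟩ := (hg.eq_zero_iff (1 - β e)).mp (by rw [map_sub, hge, map_one, sub_self])
  -- The element `d = l - m` is of the form `(0, y)`, and `e ∈ I` is `1` modulo the maximal ideal,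
  -- so that both summands of `d = d * e + d * (1 - e)` are in `I`.
  have hd : (l - m) * (1 - e) ∈ I := by
    refine h.symm.mem_of_map_left_eq_mul hg (x := t * β (l - m)) ?_ ?_ ?_
    · rw [map_sub]
      exact Ideal.mul_mem_left _ t (Ideal.sub_mem _ hl2 (Ideal.mem_map_of_mem β hm))
    · rw [map_mul, map_sub β 1 e, map_one, ht]
      ring
    · rw [map_mul, map_sub, hml, sub_self, zero_mul]
  have : l = (l - m) * (1 - e) + (l - m) * e + m := by ring
  rw [this]
  exact I.add_mem (I.add_mem hd (I.mul_mem_left _ he)) hm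

/-! ### Graphs of isomorphisms between residue lines -/

section Graph

variable {ϖ : A} {ϖ' : B} {I₁ : Ideal A} {I₂ : Ideal B} {φ : A → ZMod p} {ψ : B → ZMod p}

/-- The ideal of the elements of `I₁ × I₂` in `Λ` whose residues in the lines `I₁ / ϖ I₁` and
`I₂ / ϖ' I₂` correspond under the isomorphism of lines given by the factor `u`. -/
def graphIdeal (h : IsFiberProduct α β f g) (hφ : IsResidueCoordinate f ϖ I₁ φ)
    (hψ : IsResidueCoordinate g ϖ' I₂ ψ) (u : ZMod p) : Ideal Λ where
  carrier := {l | α l ∈ I₁ ∧ β l ∈ I₂ ∧ φ (α l) = u * ψ (β l)}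
  add_mem' := by
    rintro l m ⟨hl1, hl2, hl⟩ ⟨hm1, hm2, hm⟩
    refine ⟨by rw [map_add]; exact I₁.add_mem hl1 hm1,
      by rw [map_add]; exact I₂.add_mem hl2 hm2, ?_⟩
    rw [map_add, map_add, hφ.map_add _ hl1 _ hm1, hψ.map_add _ hl2 _ hm2, hl, hm, mul_add]
  zero_mem' := by
    refine ⟨by simp, by simp, ?_⟩
    rw [map_zero, map_zero, hφ.map_zero, hψ.map_zero, mul_zero]
  smul_mem' := by
    rintro c l ⟨hl1, hl2, hl⟩
    simp only [smul_eq_mul, Set.mem_ofPred_eq, map_mul]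
    refine ⟨I₁.mul_mem_left _ hl1, I₂.mul_mem_left _ hl2, ?_⟩
    rw [hφ.map_mul _ _ hl1, hψ.map_mul _ _ hl2, hl, h.comm]
    ring

variable (h : IsFiberProduct α β f g) (hφ : IsResidueCoordinate f ϖ I₁ φ)
  (hψ : IsResidueCoordinate g ϖ' I₂ ψ)

theorem mem_graphIdeal {u : ZMod p} {l : Λ} :
    l ∈ h.graphIdeal hφ hψ u ↔ α l ∈ I₁ ∧ β l ∈ I₂ ∧ φ (α l) = u * ψ (β l) := Iff.rfl

theorem index_graphIdeal (h₁ : I₁ ≤ RingHom.ker f) (h₂ : I₂ ≤ RingHom.ker g) (u : ZMod p) :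
    (h.graphIdeal hφ hψ u).toAddSubgroup.index =
      I₁.toAddSubgroup.index * I₂.toAddSubgroup.index := by
  refine h.index_of_character (fun x y => φ x - u * ψ y) ?_ ?_ ?_ ?_
  · intro x hx y hy x' hx' y' hy'
    rw [hφ.map_add x hx x' hx', hψ.map_add y hy y' hy']
    ring
  · intro c
    obtain ⟨x, hx, hxc⟩ := hφ.exists_eq c
    exact ⟨x, hx, 0, I₂.zero_mem, by rw [hxc, hψ.map_zero, mul_zero, sub_zero]⟩
  · intro l
    rw [mem_graphIdeal, sub_eq_zero]
  · intro x hx y hy _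
    exact (h₁ hx).trans (h₂ hy).symm

theorem map_left_graphIdeal (h₁ : I₁ ≤ RingHom.ker f) (h₂ : I₂ ≤ RingHom.ker g) (u : (ZMod p)ˣ) :
    (h.graphIdeal hφ hψ u).map α = I₁ := by
  ext x
  rw [h.mem_map_left]
  constructor
  · rintro ⟨l, hl, rfl⟩
    exact hl.1
  · intro hx
    obtain ⟨y, hy, hyx⟩ := hψ.exists_eq (u⁻¹ * φ x)
    obtain ⟨l, rfl, rfl⟩ := h.exists_lift x y ((h₁ hx).trans (h₂ hy).symm)
    exact ⟨l, ⟨hx, hy, by rw [hyx, Units.mul_inv_cancel_left]⟩, rfl⟩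

theorem map_right_graphIdeal (h₁ : I₁ ≤ RingHom.ker f) (h₂ : I₂ ≤ RingHom.ker g) (u : ZMod p) :
    (h.graphIdeal hφ hψ u).map β = I₂ := by
  ext y
  rw [h.mem_map_right]
  constructor
  · rintro ⟨l, hl, rfl⟩
    exact hl.2.1
  · intro hy
    obtain ⟨x, hx, hxy⟩ := hφ.exists_eq (u * ψ y)
    obtain ⟨l, rfl, rfl⟩ := h.exists_lift x y ((h₁ hx).trans (h₂ hy).symm)
    exact ⟨l, ⟨hx, hy, hxy⟩, rfl⟩

include h in
theorem graphIdeal_injective (h₁ : I₁ ≤ RingHom.ker f) (h₂ : I₂ ≤ RingHom.ker g) :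
    Function.Injective (h.graphIdeal hφ hψ) := by
  intro u v huv
  obtain ⟨y, hy, hy1⟩ := hψ.exists_eq_one
  obtain ⟨x, hx, hxu⟩ := hφ.exists_eq u
  obtain ⟨l, rfl, rfl⟩ := h.exists_lift x y ((h₁ hx).trans (h₂ hy).symm)
  have hl : l ∈ h.graphIdeal hφ hψ u := ⟨hx, hy, by rw [hy1, hxu, mul_one]⟩
  rw [huv] at hl
  have := hl.2.2
  rwa [hy1, hxu, mul_one] at this

theorem graphIdeal_ne_comap_inf_comap (h₁ : I₁ ≤ RingHom.ker f) (u : ZMod p) :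
    h.graphIdeal hφ hψ u ≠ I₁.comap α ⊓ I₂.comap β := by
  intro heq
  obtain ⟨x, hx, hx1⟩ := hφ.exists_eq_one
  obtain ⟨l, rfl, hl⟩ := h.exists_lift x 0 ((h₁ hx).trans (map_zero g).symm)
  have hlW : l ∈ I₁.comap α ⊓ I₂.comap β := ⟨hx, show β l ∈ I₂ by rw [hl]; exact I₂.zero_mem⟩
  rw [← heq] at hlW
  have := hlW.2.2
  rw [hx1, hl, hψ.map_zero, mul_zero] at this
  exact one_ne_zero this

/-- Goursat's lemma for ideals: an ideal of `Λ` with projections `I₁` and `I₂` inside the maximal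
ideals contains `ϖ I₁ × ϖ' I₂`, and its image in the plane `I₁ / ϖ I₁ × I₂ / ϖ' I₂` surjects onto
both lines.  So it is the whole plane or the graph of an isomorphism of lines. -/
theorem eq_comap_inf_comap_or_graphIdeal (hf : IsPrincipalResidue f ϖ)
    (hg : IsPrincipalResidue g ϖ') {I : Ideal Λ} (hI₁ : I.map α = I₁) (hI₂ : I.map β = I₂) :
    I = I₁.comap α ⊓ I₂.comap β ∨ ∃ u : (ZMod p)ˣ, I = h.graphIdeal hφ hψ u := by
  have hα : ∀ l ∈ I, α l ∈ I₁ := fun l hl => hI₁ ▸ Ideal.mem_map_of_mem α hl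
  have hβ : ∀ l ∈ I, β l ∈ I₂ := fun l hl => hI₂ ▸ Ideal.mem_map_of_mem β hl
  have hmem : ∀ l, α l ∈ I₁ → β l ∈ I₂ → φ (α l) = 0 → ψ (β l) = 0 → l ∈ I := by
    intro l h1 h2 h1' h2'
    obtain ⟨x, hx, hxl⟩ := hφ.exists_mul _ h1 h1'
    obtain ⟨y, hy, hyl⟩ := hψ.exists_mul _ h2 h2'
    obtain ⟨m, hm1, hm2⟩ := h.exists_lift (α l) 0
      (by rw [map_zero, hf.eq_zero_iff]; exact ⟨x, hxl⟩)
    have hm : m ∈ I := h.mem_of_map_left_eq_mul hf (hI₁ ▸ hx) (hm1.trans hxl) hm2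
    have hlm : l - m ∈ I := h.symm.mem_of_map_left_eq_mul hg (hI₂ ▸ hy)
      (by rw [map_sub, hm2, sub_zero, hyl]) (by rw [map_sub, hm1, sub_self])
    simpa using I.add_mem hlm hm
  have hsub : ∀ l m c, α l ∈ I₁ → m ∈ I → φ (α (l - c * m)) = φ (α l) - g (β c) * φ (α m) := by
    intro l m c hl hm
    rw [map_sub, map_mul, hφ.map_sub hl (I₁.mul_mem_left _ (hα m hm)), hφ.map_mul _ _ (hα m hm),
      h.comm]
  have hsub' : ∀ l m c, β l ∈ I₂ → m ∈ I → ψ (β (l - c * m)) = ψ (β l) - g (β c) * ψ (β m) := by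
    intro l m c hl hm
    rw [map_sub, map_mul, hψ.map_sub hl (I₂.mul_mem_left _ (hβ m hm)), hψ.map_mul _ _ (hβ m hm)]
  have hscal : ∀ t : ZMod p, ∃ c, g (β c) = t :=
    fun t => ((ZMod.ringHom_surjective g).comp h.surjective_right) t
  have hmem' : ∀ l m c, α l ∈ I₁ → β l ∈ I₂ → m ∈ I → φ (α l) = g (β c) * φ (α m) →
      ψ (β l) = g (β c) * ψ (β m) → l ∈ I := by
    intro l m c h1 h2 hm h1' h2'
    have : l - c * m ∈ I := by
      refine hmem _ ?_ ?_ ?_ ?_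
      · rw [map_sub, map_mul]
        exact I₁.sub_mem h1 (I₁.mul_mem_left _ (hα m hm))
      · rw [map_sub, map_mul]
        exact I₂.sub_mem h2 (I₂.mul_mem_left _ (hβ m hm))
      · rw [hsub l m c h1 hm, h1', sub_self]
      · rw [hsub' l m c h2 hm, h2', sub_self]
    simpa using I.add_mem this (I.mul_mem_left c hm)
  by_cases hcase : ∃ l ∈ I, φ (α l) = 0 ∧ ψ (β l) ≠ 0
  · left
    obtain ⟨l₀, hl₀, hφ0, hψ0⟩ := hcase
    refine le_antisymm (fun l hl => ⟨hα l hl, hβ l hl⟩) ?_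
    rintro l ⟨hl1, hl2⟩
    have hl2 : β l ∈ I₂ := hl2
    have hl1 : α l ∈ I.map α := hI₁ ▸ hl1
    obtain ⟨m, hm, hml⟩ := h.mem_map_left.mp hl1
    -- `l - m = (0, y)` has the residues of a multiple of `l₀`.
    obtain ⟨c, hc⟩ := hscal (ψ (β (l - m)) / ψ (β l₀))
    have hlm : l - m ∈ I := by
      refine hmem' _ l₀ c ?_ ?_ hl₀ ?_ ?_
      · rw [map_sub, hml, sub_self]
        exact I₁.zero_mem
      · rw [map_sub]
        exact I₂.sub_mem hl2 (hβ m hm)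
      · rw [map_sub, hml, sub_self, hφ.map_zero, hφ0, mul_zero]
      · rw [hc, div_mul_cancel₀ _ hψ0]
    simpa using I.add_mem hlm hm
  · right
    push Not at hcase
    obtain ⟨x, hx, hx1⟩ := hφ.exists_eq_one
    rw [← hI₁] at hx
    obtain ⟨l₀, hl₀, rfl⟩ := h.mem_map_left.mp hx
    have hlin : ∀ l ∈ I, ψ (β l) = φ (α l) * ψ (β l₀) := by
      intro l hl
      obtain ⟨c, hc⟩ := hscal (φ (α l))
      have h0 := hcase (l - c * l₀) (I.sub_mem hl (I.mul_mem_left c hl₀))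
        (by rw [hsub l l₀ c (hα l hl) hl₀, hx1, hc, mul_one, sub_self])
      rw [hsub' l l₀ c (hβ l hl) hl₀, hc] at h0
      exact sub_eq_zero.mp h0
    have hne : ψ (β l₀) ≠ 0 := by
      obtain ⟨y, hy, hy1⟩ := hψ.exists_eq_one
      rw [← hI₂] at hy
      obtain ⟨l, hl, rfl⟩ := h.mem_map_right.mp hy
      intro h0
      have := hlin l hl
      rw [hy1, h0, mul_zero] at this
      exact one_ne_zero this
    refine ⟨(Units.mk0 _ hne)⁻¹, le_antisymm ?_ ?_⟩
    · intro l hl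
      refine ⟨hα l hl, hβ l hl, ?_⟩
      rw [hlin l hl, Units.val_inv_eq_inv_val, Units.val_mk0, mul_comm, mul_inv_cancel_right₀ hne]
    · rintro l ⟨hl1, hl2, hl⟩
      obtain ⟨c, hc⟩ := hscal (φ (α l))
      refine hmem' l l₀ c hl1 hl2 hl₀ (by rw [hc, hx1, mul_one]) ?_
      rw [hc, hl, Units.val_inv_eq_inv_val, Units.val_mk0, mul_comm, mul_inv_cancel_left₀ hne]

end Graph

end IsFiberProduct

/-! ### The zeta function of a fibre product -/

namespace IsFiberProduct

variable {Λ A B : Type*} [CommRing Λ] [CommRing A] [CommRing B] {p : ℕ}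
  {α : Λ →+* A} {β : Λ →+* B} {f : A →+* ZMod p} {g : B →+* ZMod p} {ϖ : A} {ϖ' : B}

/-- The closed form of the sum of `F [Λ : I]` over the ideals `I` of `Λ = A ×_{𝔽_p} B` with given
projections to `A` and `B` (see `hasSum_fiber`).  The intended `F` are `n ↦ n ^ (-s)` and its
absolute value.  The first projection lies in `ker f` exactly if the second lies in `ker g`; this
accounts for the two values `0`. -/
noncomputable def fiberWeight {E : Type*} [AddCommMonoid E] (F : ℕ → E) (f : A →+* ZMod p)
    (g : B →+* ZMod p) (I : Ideal A × Ideal B) : E :=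
  open scoped Classical in
  if I.1 ≤ RingHom.ker f then
    if I.2 ≤ RingHom.ker g then
      F (I.1.toAddSubgroup.index * I.2.toAddSubgroup.index / p) +
        (p - 1) • F (I.1.toAddSubgroup.index * I.2.toAddSubgroup.index)
    else 0
  else if I.2 ≤ RingHom.ker g then 0
  else F (I.1.toAddSubgroup.index * I.2.toAddSubgroup.index)

theorem index_map_ne_zero (h : IsFiberProduct α β f g) {I : Ideal Λ}
    (hI : I.toAddSubgroup.index ≠ 0) : (I.map α).toAddSubgroup.index ≠ 0 := by
  have : (I.map α).toAddSubgroup = I.toAddSubgroup.map α.toAddMonoidHom := by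
    ext x
    exact h.mem_map_left
  rw [this]
  exact fun h0 => hI (Nat.eq_zero_of_zero_dvd
    (h0 ▸ AddSubgroup.index_map_dvd I.toAddSubgroup h.surjective_left))

variable [Fact p.Prime]

theorem index_comap_inf_comap_of_not_le (h : IsFiberProduct α β f g) {I₁ : Ideal A} {I₂ : Ideal B}
    (h₁ : ¬ I₁ ≤ RingHom.ker f) :
    (I₁.comap α ⊓ I₂.comap β).toAddSubgroup.index =
      I₁.toAddSubgroup.index * I₂.toAddSubgroup.index := by
  refine h.index_of_character (fun x y => f x - g y) ?_ ?_ ?_ ?_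
  · intro x _ y _ x' _ y' _
    rw [map_add, map_add]
    ring
  · intro c
    obtain ⟨x, hx, hxc⟩ := exists_mem_eq_of_not_le_ker h₁ c
    exact ⟨x, hx, 0, I₂.zero_mem, by rw [hxc, map_zero, sub_zero]⟩
  · intro l
    rw [h.comm, sub_self]
    exact ⟨fun hl => ⟨hl.1, hl.2, rfl⟩, fun hl => ⟨hl.1, hl.2.1⟩⟩
  · intro x _ y _ hxy
    exact sub_eq_zero.mp hxy

/-- The sum of `F [Λ : I]` over the ideals `I` with given projections. -/
theorem hasSum_fiber (h : IsFiberProduct α β f g) (hf : IsPrincipalResidue f ϖ)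
    (hg : IsPrincipalResidue g ϖ') {E : Type*} [AddCommMonoid E] [TopologicalSpace E]
    (F : ℕ → E) (hF : F 0 = 0) (P : Ideal A × Ideal B) :
    HasSum (fun I : {I : Ideal Λ // (I.map α, I.map β) = P} => F I.1.toAddSubgroup.index)
      (fiberWeight F f g P) := by
  classical
  obtain ⟨I₁, I₂⟩ := P
  have hmap : ∀ I : {I : Ideal Λ // (I.map α, I.map β) = (I₁, I₂)},
      I.1.map α = I₁ ∧ I.1.map β = I₂ := fun I => Prod.mk.inj I.2
  by_cases hn : I₁.toAddSubgroup.index * I₂.toAddSubgroup.index = 0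
  · have : fiberWeight F f g (I₁, I₂) = 0 := by
      simp [fiberWeight, hn, hF]
    rw [this]
    convert! hasSum_zero using 2 with I
    by_cases hI : I.1.toAddSubgroup.index = 0
    · rw [hI, hF]
    · obtain ⟨h1, h2⟩ := hmap I
      have h3 := h.index_map_ne_zero hI
      have h4 := h.symm.index_map_ne_zero hI
      rw [h1] at h3
      rw [h2] at h4
      exact absurd hn (mul_ne_zero h3 h4)
  obtain ⟨hn₁, hn₂⟩ := mul_ne_zero_iff.mp hn
  unfold fiberWeight
  dsimp only
  split_ifs with h₁ h₂ h₂
  · obtain ⟨φ, hφ⟩ := hf.exists_residueCoordinate I₁ hn₁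
    obtain ⟨ψ, hψ⟩ := hg.exists_residueCoordinate I₂ hn₂
    let e : Option (ZMod p)ˣ → {I : Ideal Λ // (I.map α, I.map β) = (I₁, I₂)} := fun o =>
      o.elim
        ⟨I₁.comap α ⊓ I₂.comap β, Prod.ext
          (h.map_left_comap_inf_comap fun x hx => ⟨0, I₂.zero_mem, (h₁ hx).trans (map_zero g).symm⟩)
          (by
            rw [inf_comm]
            exact h.symm.map_left_comap_inf_comap fun x hx =>
              ⟨0, I₁.zero_mem, (h₂ hx).trans (map_zero f).symm⟩)⟩
        (fun u => ⟨h.graphIdeal hφ hψ u, Prod.ext (h.map_left_graphIdeal hφ hψ h₁ h₂ u)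
          (h.map_right_graphIdeal hφ hψ h₁ h₂ u)⟩)
    have he : Function.Bijective e := by
      constructor
      · rintro (_ | u) (_ | v) huv
        · rfl
        · exact absurd (congrArg Subtype.val huv).symm
            (h.graphIdeal_ne_comap_inf_comap hφ hψ h₁ v)
        · exact absurd (congrArg Subtype.val huv) (h.graphIdeal_ne_comap_inf_comap hφ hψ h₁ u)
        · rw [Units.ext (h.graphIdeal_injective hφ hψ h₁ h₂ (congrArg Subtype.val huv))]
      · intro I
        obtain ⟨h3, h4⟩ := hmap I
        rcases h.eq_comap_inf_comap_or_graphIdeal hφ hψ hf hg h3 h4 with hI | ⟨u, hI⟩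
        · exact ⟨none, Subtype.ext hI.symm⟩
        · exact ⟨some u, Subtype.ext hI.symm⟩
    rw [← (Equiv.ofBijective e he).hasSum_iff]
    convert! hasSum_fintype _ using 1
    rw [Fintype.sum_option]
    congr 1
    · change _ = F (I₁.comap α ⊓ I₂.comap β).toAddSubgroup.index
      rw [← h.index_comap_inf_comap h₁ h₂, Nat.mul_div_cancel _ (Fact.out : p.Prime).pos]
    · have hu : ∀ u : (ZMod p)ˣ, F (e (some u)).1.toAddSubgroup.index =
          F (I₁.toAddSubgroup.index * I₂.toAddSubgroup.index) :=
        fun u => congrArg F (h.index_graphIdeal hφ hψ h₁ h₂ u)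
      simp only [Function.comp_apply, Equiv.ofBijective_apply, hu]
      rw [Finset.sum_const, Finset.card_univ, ZMod.card_units]
  · have : IsEmpty {I : Ideal Λ // (I.map α, I.map β) = (I₁, I₂)} := ⟨fun I => by
      obtain ⟨h3, h4⟩ := hmap I
      have := h.map_left_le_ker_iff I.1
      rw [h3, h4] at this
      exact h₂ (this.mp h₁)⟩
    exact hasSum_empty
  · have : IsEmpty {I : Ideal Λ // (I.map α, I.map β) = (I₁, I₂)} := ⟨fun I => by
      obtain ⟨h3, h4⟩ := hmap I
      have := h.map_left_le_ker_iff I.1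
      rw [h3, h4] at this
      exact h₁ (this.mpr h₂)⟩
    exact hasSum_empty
  · let I₀ : {I : Ideal Λ // (I.map α, I.map β) = (I₁, I₂)} :=
      ⟨I₁.comap α ⊓ I₂.comap β, Prod.ext
        (h.map_left_comap_inf_comap fun x _ =>
          (exists_mem_eq_of_not_le_ker h₂ (f x)).imp fun _ hy => ⟨hy.1, hy.2.symm⟩)
        (by
          rw [inf_comm]
          exact h.symm.map_left_comap_inf_comap fun x _ =>
            (exists_mem_eq_of_not_le_ker h₁ (g x)).imp fun _ hy => ⟨hy.1, hy.2.symm⟩)⟩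
    have hI₀ : ∀ I, I = I₀ := by
      intro I
      obtain ⟨h3, h4⟩ := hmap I
      refine Subtype.ext ?_
      have := h.eq_comap_inf_comap hg (I := I.1) (by rwa [h4])
      rwa [h3, h4] at this
    rw [← h.index_comap_inf_comap_of_not_le (I₂ := I₂) h₁]
    exact hasSum_single I₀ fun I hI => absurd (hI₀ I) hI

/-- The sum over all ideals of `Λ`, reduced to a sum over pairs of ideals. -/
theorem hasSum_of_fiberWeight (h : IsFiberProduct α β f g) (hf : IsPrincipalResidue f ϖ)
    (hg : IsPrincipalResidue g ϖ') (F : ℕ → ℂ) (hF : F 0 = 0) {z : ℂ}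
    (hz : HasSum (fiberWeight F f g) z)
    (hz' : Summable (fiberWeight (fun n => ‖F n‖) f g)) :
    HasSum (fun I : Ideal Λ => F I.toAddSubgroup.index) z := by
  have hsum : Summable fun I : Ideal Λ => F I.toAddSubgroup.index := by
    refine Summable.of_norm ?_
    rw [← (Equiv.sigmaFiberEquiv fun I : Ideal Λ => (I.map α, I.map β)).summable_iff]
    have key := h.hasSum_fiber hf hg (fun n => ‖F n‖) (by simp [hF])
    refine (summable_sigma_of_nonneg fun _ => norm_nonneg _).mpr ⟨fun P => (key P).summable, ?_⟩
    exact hz'.congr fun P => (key P).tsum_eq.symm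
  have h1 := ((Equiv.sigmaFiberEquiv fun I : Ideal Λ => (I.map α, I.map β)).hasSum_iff.mpr
    hsum.hasSum).sigma fun P => h.hasSum_fiber hf hg F hF P
  rw [hz.unique h1]
  exact hsum.hasSum

end IsFiberProduct

/-- The part of the sum over the ideals of `A` coming from those inside the maximal ideal `ϖ A`;
these are the ideals `ϖ I`. -/
theorem IsPrincipalResidue.hasSum_indicator {A : Type*} [CommRing A] {p : ℕ} [Fact p.Prime]
    {f : A →+* ZMod p} {ϖ : A} (hf : IsPrincipalResidue f ϖ) {𝕜 : Type*} [NormedField 𝕜]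
    (F : ℕ →*₀ 𝕜) {z : 𝕜} (hz : HasSum (fun I : Ideal A => F I.toAddSubgroup.index) z) :
    HasSum (Set.indicator {I : Ideal A | I ≤ RingHom.ker f} fun I => F I.toAddSubgroup.index)
      (z * F p) := by
  rw [← hf.span_mul_injective.hasSum_iff]
  · refine (hz.mul_right (F p)).congr_fun fun I => ?_
    have hI : Ideal.span {ϖ} * I ∈ {I : Ideal A | I ≤ RingHom.ker f} :=
      (hf.mem_range_span_mul_iff _).mp ⟨I, rfl⟩
    rw [Function.comp_apply, Set.indicator_of_mem hI, hf.index_span_mul, map_mul]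
  · intro I hI
    rw [hf.mem_range_span_mul_iff] at hI
    exact Set.indicator_of_notMem hI _

theorem HasSum.mul_of_summable_norm {X Y 𝕜 : Type*} [NormedRing 𝕜] [CompleteSpace 𝕜] {a : X → 𝕜}
    {b : Y → 𝕜} {x y : 𝕜} (ha : HasSum a x) (hb : HasSum b y) (hna : Summable fun i => ‖a i‖)
    (hnb : Summable fun i => ‖b i‖) : HasSum (fun i : X × Y => a i.1 * b i.2) (x * y) :=
  ha.mul hb (summable_mul_of_summable_norm hna hnb)

/-- Pairs of ideals outside the maximal ideals contribute `(1 - F p) ^ 2`, and pairs inside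
contribute `((F p)⁻¹ + p - 1) (F p) ^ 2`, times the product of the sums over `A` and `B`. -/
theorem IsFiberProduct.hasSum_fiberWeight {A B : Type*} [CommRing A] [CommRing B] {p : ℕ}
    [Fact p.Prime] {f : A →+* ZMod p} {g : B →+* ZMod p} {ϖ : A} {ϖ' : B}
    (hf : IsPrincipalResidue f ϖ) (hg : IsPrincipalResidue g ϖ') {𝕜 : Type*} [NormedField 𝕜]
    [CompleteSpace 𝕜] (F : ℕ →*₀ 𝕜) (hFp : F p ≠ 0) {zA zB : 𝕜}
    (hA : HasSum (fun I : Ideal A => F I.toAddSubgroup.index) zA)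
    (hB : HasSum (fun I : Ideal B => F I.toAddSubgroup.index) zB)
    (hA_norm : Summable fun I : Ideal A => ‖F I.toAddSubgroup.index‖)
    (hB_norm : Summable fun I : Ideal B => ‖F I.toAddSubgroup.index‖) :
    HasSum (fiberWeight F f g) ((p * F p ^ 2 - F p + 1) * zA * zB) := by
  have hp : p.Prime := Fact.out
  set a : Ideal A → 𝕜 := fun I => F I.toAddSubgroup.index with ha
  set b : Ideal B → 𝕜 := fun I => F I.toAddSubgroup.index with hb
  set a' : Ideal A → 𝕜 := Set.indicator {I : Ideal A | I ≤ RingHom.ker f} a with ha'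
  set b' : Ideal B → 𝕜 := Set.indicator {I : Ideal B | I ≤ RingHom.ker g} b with hb'
  have hA' : HasSum a' (zA * F p) := hf.hasSum_indicator F hA
  have hB' : HasSum b' (zB * F p) := hg.hasSum_indicator F hB
  have hnA' : Summable fun I => ‖a' I‖ :=
    hA_norm.of_nonneg_of_le (fun _ => norm_nonneg _) fun _ => norm_indicator_le_norm_self _ _
  have hnB' : Summable fun I => ‖b' I‖ :=
    hB_norm.of_nonneg_of_le (fun _ => norm_nonneg _) fun _ => norm_indicator_le_norm_self _ _
  have hnA : Summable fun I => ‖a I - a' I‖ :=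
    (hA_norm.add hnA').of_nonneg_of_le (fun _ => norm_nonneg _) fun _ => norm_sub_le _ _
  have hnB : Summable fun I => ‖b I - b' I‖ :=
    (hB_norm.add hnB').of_nonneg_of_le (fun _ => norm_nonneg _) fun _ => norm_sub_le _ _
  have hout := (hA.sub hA').mul_of_summable_norm (hB.sub hB') hnA hnB
  have hin := (hA'.mul_of_summable_norm hB' hnA' hnB').mul_left ((F p)⁻¹ + (p - 1))
  have hval : (zA - zA * F p) * (zB - zB * F p) +
      ((F p)⁻¹ + (p - 1)) * (zA * F p * (zB * F p)) = (p * F p ^ 2 - F p + 1) * zA * zB := by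
    field_simp
    ring
  rw [← hval]
  refine (hout.add hin).congr_fun ?_
  rintro ⟨I, J⟩
  dsimp only [fiberWeight]
  split_ifs with hI hJ hJ
  · have e1 : a' I = a I := Set.indicator_of_mem (s := {I : Ideal A | I ≤ RingHom.ker f}) hI _
    have e2 : b' J = b J := Set.indicator_of_mem (s := {J : Ideal B | J ≤ RingHom.ker g}) hJ _
    obtain ⟨I', rfl⟩ := (hf.mem_range_span_mul_iff I).mpr hI
    rw [e1, e2]
    simp only [ha, hb, hf.index_span_mul, map_mul]
    rw [mul_right_comm, Nat.mul_div_cancel _ hp.pos, map_mul, nsmul_eq_mul,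
      Nat.cast_sub hp.one_le, Nat.cast_one]
    field_simp
    ring
  · have e1 : a' I = a I := Set.indicator_of_mem (s := {I : Ideal A | I ≤ RingHom.ker f}) hI _
    have e2 : b' J = 0 := Set.indicator_of_notMem (s := {J : Ideal B | J ≤ RingHom.ker g}) hJ _
    rw [e1, e2]
    ring
  · have e1 : a' I = 0 := Set.indicator_of_notMem (s := {I : Ideal A | I ≤ RingHom.ker f}) hI _
    have e2 : b' J = b J := Set.indicator_of_mem (s := {J : Ideal B | J ≤ RingHom.ker g}) hJ _
    rw [e1, e2]
    ring
  · have e1 : a' I = 0 := Set.indicator_of_notMem (s := {I : Ideal A | I ≤ RingHom.ker f}) hI _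
    have e2 : b' J = 0 := Set.indicator_of_notMem (s := {J : Ideal B | J ≤ RingHom.ker g}) hJ _
    rw [e1, e2, map_mul]
    ring

/-- The zeta function of a fibre product over `𝔽_p` of two rings in which the ideal glued along is
generated by a non-zero-divisor. -/
theorem HasIdealZeta.of_isFiberProduct {Λ A B : Type*} [CommRing Λ] [CommRing A] [CommRing B]
    {p : ℕ} {α : Λ →+* A} {β : Λ →+* B} {f : A →+* ZMod p} {g : B →+* ZMod p} [Fact p.Prime]
    {ϖ : A} {ϖ' : B} {zA zB : ℂ → ℂ} (hA : HasIdealZeta A zA) (hB : HasIdealZeta B zB)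
    (h : IsFiberProduct α β f g) (hf : IsPrincipalResidue f ϖ) (hg : IsPrincipalResidue g ϖ') :
    HasIdealZeta Λ fun s => ((p : ℂ) ^ (1 - 2 * s) - (p : ℂ) ^ (-s) + 1) * zA s * zB s := by
  intro s hs
  have hs0 : s ≠ 0 := neg_ne_zero.mp (neg_ne_zero_of_one_lt_re hs)
  have hp : (p : ℂ) ≠ 0 := Nat.cast_ne_zero.mpr (Fact.out : p.Prime).ne_zero
  let F : ℕ →*₀ ℂ := riemannZetaSummandHom hs0
  have hFp : F p ≠ 0 := fun h0 => hp (Complex.cpow_eq_zero_iff _ _ |>.mp h0).1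
  have hA1 : HasSum (fun I : Ideal A => F I.toAddSubgroup.index) (zA s) := hA s hs
  have hB1 : HasSum (fun I : Ideal B => F I.toAddSubgroup.index) (zB s) := hB s hs
  have hA2 : Summable fun I : Ideal A => ‖F I.toAddSubgroup.index‖ := hA1.summable.norm
  have hB2 : Summable fun I : Ideal B => ‖F I.toAddSubgroup.index‖ := hB1.summable.norm
  have h1 := IsFiberProduct.hasSum_fiberWeight hf hg F hFp hA1 hB1 hA2 hB2
  have h2 := IsFiberProduct.hasSum_fiberWeight hf hg ((normHom : ℂ →*₀ ℝ).comp F)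
    (norm_ne_zero_iff.mpr hFp) hA2.hasSum hB2.hasSum
    (hA2.congr fun _ => (norm_norm _).symm) (hB2.congr fun _ => (norm_norm _).symm)
  have h3 := h.hasSum_of_fiberWeight hf hg F (map_zero F) h1 h2.summable
  have h4 : (p : ℂ) ^ (1 - 2 * s) = p * F p ^ 2 := by
    change _ = (p : ℂ) * ((p : ℂ) ^ (-s)) ^ 2
    rw [sq, ← Complex.cpow_add _ _ hp, sub_eq_add_neg, Complex.cpow_add _ _ hp, Complex.cpow_one]
    congr 2
    ring
  rw [← h4] at h3
  exact h3

/-! ### Homomorphisms out of fusion rings and quadratic algebras -/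

namespace FusionData

variable {ι : Type} [Fintype ι] [DecidableEq ι] (F : FusionData ι) {S : Type*} [CommRing S]

/-- The ring homomorphism from a fusion ring sending the basis to a family `v` which multiplies by
the fusion rules. -/
def liftHom (v : ι → S) (hone : v F.unit = 1)
    (hmul : ∀ i j, v i * v j = ∑ k, (F.N i j k : S) * v k) : F.FusionRing →+* S where
  toFun x := ∑ i, (x i : S) * v i
  map_zero' := by
    change ∑ i, ((0 : ℤ) : S) * v i = 0
    simp
  map_one' := by
    rw [Finset.sum_eq_single F.unit]
    · have h : (1 : F.FusionRing) F.unit = 1 := Pi.single_eq_same (M := fun _ : ι => ℤ) F.unit 1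
      rw [h, hone, Int.cast_one, one_mul]
    · intro i _ hi
      have h : (1 : F.FusionRing) i = 0 := Pi.single_eq_of_ne (M := fun _ : ι => ℤ) hi 1
      rw [h, Int.cast_zero, zero_mul]
    · simp
  map_add' x y := by
    simp only [add_apply, Int.cast_add, add_mul, Finset.sum_add_distrib]
  map_mul' x y := by
    calc ∑ k, ((x * y) k : S) * v k
        = ∑ i, ∑ j, (x i * y j : S) * ∑ k, (F.N i j k : S) * v k := by
          simp only [mul_apply, Int.cast_sum, Int.cast_mul, Int.cast_natCast, Finset.sum_mul,
            Finset.mul_sum]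
          rw [Finset.sum_comm]
          refine Finset.sum_congr rfl fun i _ => ?_
          rw [Finset.sum_comm]
          exact Finset.sum_congr rfl fun j _ => Finset.sum_congr rfl fun k _ => by ring
      _ = _ := by
          rw [Finset.sum_mul_sum]
          refine Finset.sum_congr rfl fun i _ => Finset.sum_congr rfl fun j _ => ?_
          rw [← hmul]
          ring

theorem liftHom_apply (v : ι → S) (hone : v F.unit = 1)
    (hmul : ∀ i j, v i * v j = ∑ k, (F.N i j k : S) * v k) (x : F.FusionRing) :
    F.liftHom v hone hmul x = ∑ i, (x i : S) * v i := rfl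

end FusionData

namespace QuadraticAlgebra

variable {a b : ℤ} {S : Type*} [CommRing S]

/-- The ring homomorphism from `ℤ[ω]`, `ω² = a + b ω`, sending `ω` to `u`. -/
def homOfRoot (u : S) (hu : u * u = a + b * u) : QuadraticAlgebra ℤ a b →+* S :=
  (lift ⟨u, by simpa [zsmul_eq_mul] using hu⟩ : QuadraticAlgebra ℤ a b →ₐ[ℤ] S)

theorem homOfRoot_apply (u : S) (hu : u * u = a + b * u) (z : QuadraticAlgebra ℤ a b) :
    homOfRoot u hu z = z.re + z.im * u := by
  change z.re • (1 : S) + z.im • u = _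
  simp [zsmul_eq_mul]

end QuadraticAlgebra

/-! ### The fusion rings with `b² = 1`, `bd = d`, `d² = 1 + b + c d` -/

theorem isPrincipalResidue_int (p : ℕ) [Fact p.Prime] :
    IsPrincipalResidue (Int.castRingHom (ZMod p)) (p : ℤ) where
  eq_zero_iff a := ZMod.intCast_zmod_eq_zero_iff_dvd a p
  eq_zero_of_mul a ha := by
    have hp : (p : ℤ) ≠ 0 := Int.natCast_ne_zero.mpr (Fact.out : p.Prime).ne_zero
    exact (mul_eq_zero.mp ha).resolve_left hp

/-- The residue map `ω ↦ 0` modulo `2` on `ℤ[ω]`, `ω² = 2 + c ω`; its kernel is generated by `ω`. -/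
def residueTwo (c : ℤ) : QuadraticAlgebra ℤ 2 c →+* ZMod 2 :=
  QuadraticAlgebra.homOfRoot 0 (by simpa using (by decide : (0 : ZMod 2) = 2))

theorem residueTwo_apply {c : ℤ} (z : QuadraticAlgebra ℤ 2 c) : residueTwo c z = z.re := by
  rw [residueTwo, QuadraticAlgebra.homOfRoot_apply, mul_zero, add_zero]

theorem isPrincipalResidue_residueTwo (c : ℤ) :
    IsPrincipalResidue (residueTwo c) (⟨0, 1⟩ : QuadraticAlgebra ℤ 2 c) where
  eq_zero_iff z := by
    rw [residueTwo_apply, ZMod.intCast_zmod_eq_zero_iff_dvd]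
    constructor
    · rintro ⟨t, ht⟩
      refine ⟨⟨z.im - c * t, t⟩, QuadraticAlgebra.ext ?_ ?_⟩
      · simpa using ht
      · simp
    · rintro ⟨w, rfl⟩
      exact ⟨w.im, by simp⟩
  eq_zero_of_mul z hz := by
    have h1 := congrArg QuadraticAlgebra.re hz
    have h2 := congrArg QuadraticAlgebra.im hz
    simp at h1 h2
    refine QuadraticAlgebra.ext ?_ ?_
    · simpa [h1] using h2
    · simpa using h1

/-- The characters `b ↦ -1, d ↦ 0` and `b ↦ 1, d ↦ ω` embed the fusion ring in `ℤ × ℤ[ω]`, with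
image the fibre product over `𝔽₂`. -/
theorem hasIdealZeta_of_fusionRules (F : FusionData (Fin 3)) (c : ℕ) (hunit : F.unit = 0)
    (hN : F.N = ![![![1, 0, 0], ![0, 1, 0], ![0, 0, 1]],
      ![![0, 1, 0], ![1, 0, 0], ![0, 0, 1]],
      ![![0, 0, 1], ![0, 0, 1], ![1, 1, c]]]) {z : ℂ → ℂ}
    (hz : HasIdealZeta (QuadraticAlgebra ℤ 2 (c : ℤ)) z) :
    HasIdealZeta F.FusionRing fun s =>
      ((2 : ℂ) ^ (1 - 2 * s) - (2 : ℂ) ^ (-s) + 1) * riemannZeta s * z s := by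
  let α : F.FusionRing →+* ℤ := F.liftHom ![1, -1, 0] (by rw [hunit]; rfl) (by
    intro i j
    rw [hN]
    fin_cases i <;> fin_cases j <;> simp [Fin.sum_univ_three])
  let β : F.FusionRing →+* QuadraticAlgebra ℤ 2 (c : ℤ) :=
    F.liftHom ![1, 1, ⟨0, 1⟩] (by rw [hunit]; rfl) (by
      intro i j
      rw [hN]
      fin_cases i <;> fin_cases j <;> ext <;>
        simp [Fin.sum_univ_three, QuadraticAlgebra.re_one, QuadraticAlgebra.im_one])
  have hα : ∀ x, α x = x 0 - x 1 := fun x => by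
    simp [α, FusionData.liftHom_apply, Fin.sum_univ_three, sub_eq_add_neg]
  have hβ : ∀ x, β x = ⟨x 0 + x 1, x 2⟩ := fun x => by
    ext <;> simp [β, FusionData.liftHom_apply, Fin.sum_univ_three]
  have h : IsFiberProduct α β (Int.castRingHom (ZMod 2)) (residueTwo c) := by
    constructor
    · intro x
      rw [hα, hβ, residueTwo_apply, eq_intCast, ZMod.intCast_eq_intCast_iff_dvd_sub]
      exact ⟨x 1, by push_cast; ring⟩
    · intro x h1 h2
      rw [hα] at h1
      rw [hβ] at h2
      have h3 := congrArg QuadraticAlgebra.re h2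
      have h4 := congrArg QuadraticAlgebra.im h2
      simp only [QuadraticAlgebra.re_zero, QuadraticAlgebra.im_zero] at h3 h4
      funext i
      change x i = 0
      fin_cases i
      · change x 0 = 0
        omega
      · change x 1 = 0
        omega
      · exact h4
    · intro a w haw
      rw [residueTwo_apply, eq_intCast, ZMod.intCast_eq_intCast_iff_dvd_sub] at haw
      obtain ⟨t, ht⟩ := haw
      push_cast at ht
      let x : F.FusionRing := (![a + t, t, w.im] : Fin 3 → ℤ)
      refine ⟨x, (hα x).trans ?_, (hβ x).trans (QuadraticAlgebra.ext ?_ rfl)⟩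
      · change a + t - t = a
        ring
      · change a + t + t = w.re
        linarith
  exact_mod_cast hasIdealZeta_int.of_isFiberProduct hz h (isPrincipalResidue_int 2)
    (isPrincipalResidue_residueTwo c)

/-- `ℤ[ω]` with `ω² = 2 + ω`, that is `(ω - 2)(ω + 1) = 0`, is the fibre product of two copies of
`ℤ` over `𝔽₃`. -/
theorem hasIdealZeta_quadraticAlgebra_two_one :
    HasIdealZeta (QuadraticAlgebra ℤ 2 1) fun s =>
      ((3 : ℂ) ^ (1 - 2 * s) - (3 : ℂ) ^ (-s) + 1) * riemannZeta s * riemannZeta s := by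
  let α : QuadraticAlgebra ℤ 2 1 →+* ℤ := QuadraticAlgebra.homOfRoot 2 (by norm_num)
  let β : QuadraticAlgebra ℤ 2 1 →+* ℤ := QuadraticAlgebra.homOfRoot (-1) (by norm_num)
  have hα : ∀ x, α x = x.re + x.im * 2 := fun x => QuadraticAlgebra.homOfRoot_apply _ _ x
  have hβ : ∀ x, β x = x.re + x.im * (-1) := fun x => QuadraticAlgebra.homOfRoot_apply _ _ x
  have h : IsFiberProduct α β (Int.castRingHom (ZMod 3)) (Int.castRingHom (ZMod 3)) := by
    constructor
    · intro x
      rw [hα, hβ, eq_intCast, eq_intCast, ZMod.intCast_eq_intCast_iff_dvd_sub]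
      exact ⟨-x.im, by push_cast; ring⟩
    · intro x h1 h2
      rw [hα] at h1
      rw [hβ] at h2
      refine QuadraticAlgebra.ext ?_ ?_
      · rw [QuadraticAlgebra.re_zero]
        omega
      · rw [QuadraticAlgebra.im_zero]
        omega
    · intro a b hab
      rw [eq_intCast, eq_intCast, ZMod.intCast_eq_intCast_iff_dvd_sub] at hab
      obtain ⟨t, ht⟩ := hab
      push_cast at ht
      refine ⟨⟨b - t, -t⟩, ?_, ?_⟩
      · rw [hα]
        change b - t + -t * 2 = a
        linarith
      · rw [hβ]
        change b - t + -t * -1 = b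
        ring
  exact_mod_cast hasIdealZeta_int.of_isFiberProduct hasIdealZeta_int h (isPrincipalResidue_int 3)
    (isPrincipalResidue_int 3)

/-! ### The group ring of the cyclic group of order three -/

/-- The residue map `ω ↦ 1` modulo `3` on `ℤ[ω]`, `ω² = -1 - ω`; its kernel is generated by
`ω - 1`. -/
def residueThree : QuadraticAlgebra ℤ (-1) (-1) →+* ZMod 3 :=
  QuadraticAlgebra.homOfRoot 1 (by push_cast; decide)

theorem residueThree_apply (z : QuadraticAlgebra ℤ (-1) (-1)) :
    residueThree z = ((z.re + z.im : ℤ) : ZMod 3) := by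
  rw [residueThree, QuadraticAlgebra.homOfRoot_apply, mul_one, Int.cast_add]

theorem isPrincipalResidue_residueThree :
    IsPrincipalResidue residueThree (⟨-1, 1⟩ : QuadraticAlgebra ℤ (-1) (-1)) where
  eq_zero_iff z := by
    rw [residueThree_apply, ZMod.intCast_zmod_eq_zero_iff_dvd]
    constructor
    · rintro ⟨t, ht⟩
      push_cast at ht
      refine ⟨⟨t - z.re, -t⟩, QuadraticAlgebra.ext ?_ ?_⟩
      · simp
      · simp
        linarith
    · rintro ⟨w, rfl⟩
      exact ⟨-w.im, by simp; ring⟩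
  eq_zero_of_mul z hz := by
    have h1 := congrArg QuadraticAlgebra.re hz
    have h2 := congrArg QuadraticAlgebra.im hz
    simp at h1 h2
    refine QuadraticAlgebra.ext ?_ ?_
    · rw [QuadraticAlgebra.re_zero]
      omega
    · rw [QuadraticAlgebra.im_zero]
      omega

/-- The character of the cyclic group of order three sending the generator to `u`. -/
def cyclicThreeHom {S : Type*} [CommRing S] (u : S) (hu : u ^ 3 = 1) :
    Multiplicative (ZMod 3) →* S where
  toFun g := u ^ (Multiplicative.toAdd g).val
  map_one' := by simp
  map_mul' g h := by
    rw [toAdd_mul, ZMod.val_add, ← pow_add]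
    exact (pow_eq_pow_mod _ hu).symm

theorem lift_cyclicThreeHom_apply {S : Type*} [CommRing S] (u : S) (hu : u ^ 3 = 1)
    (x : GroupRingC3) :
    MonoidAlgebra.lift ℤ S (Multiplicative (ZMod 3)) (cyclicThreeHom u hu) x =
      x.coeff (Multiplicative.ofAdd 0) + x.coeff (Multiplicative.ofAdd 1) * u +
        x.coeff (Multiplicative.ofAdd 2) * u ^ 2 := by
  rw [MonoidAlgebra.lift_apply, Finsupp.sum_fintype _ _ (by simp),
    ← Multiplicative.ofAdd.sum_comp]
  simp only [zsmul_eq_mul]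
  refine (Fin.sum_univ_three _).trans ?_
  congr 1
  · congr 1
    · exact (congrArg (((x.coeff (Multiplicative.ofAdd 0) : ℤ) : S) * ·) (pow_zero u)).trans
        (mul_one _)
    · exact congrArg (((x.coeff (Multiplicative.ofAdd 1) : ℤ) : S) * ·) (pow_one u)

/-- The trivial character and the character `g ↦ ω` embed the group ring in `ℤ × ℤ[ω]`, with
image the fibre product over `𝔽₃`. -/
theorem hasIdealZeta_groupRingC3 {z : ℂ → ℂ}
    (hz : HasIdealZeta (QuadraticAlgebra ℤ (-1) (-1)) z) :
    HasIdealZeta GroupRingC3 fun s =>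
      ((3 : ℂ) ^ (1 - 2 * s) - (3 : ℂ) ^ (-s) + 1) * riemannZeta s * z s := by
  let ω : QuadraticAlgebra ℤ (-1) (-1) := ⟨0, 1⟩
  have hω2 : ω ^ 2 = ⟨-1, -1⟩ := by
    rw [sq]
    ext <;> simp [ω]
  have hω : ω ^ 3 = 1 := by
    rw [pow_succ, hω2]
    ext <;> simp [ω, QuadraticAlgebra.re_one, QuadraticAlgebra.im_one]
  let α : GroupRingC3 →+* ℤ :=
    (MonoidAlgebra.lift ℤ ℤ (Multiplicative (ZMod 3)) (cyclicThreeHom 1 (one_pow 3))).toRingHom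
  let β : GroupRingC3 →+* QuadraticAlgebra ℤ (-1) (-1) :=
    (MonoidAlgebra.lift ℤ _ (Multiplicative (ZMod 3)) (cyclicThreeHom ω hω)).toRingHom
  have hα : ∀ x : GroupRingC3, α x = x.coeff (Multiplicative.ofAdd 0) +
      x.coeff (Multiplicative.ofAdd 1) + x.coeff (Multiplicative.ofAdd 2) := fun x =>
    (lift_cyclicThreeHom_apply 1 (one_pow 3) x).trans (by simp)
  have hβ : ∀ x : GroupRingC3, β x =
      ⟨x.coeff (Multiplicative.ofAdd 0) - x.coeff (Multiplicative.ofAdd 2),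
        x.coeff (Multiplicative.ofAdd 1) - x.coeff (Multiplicative.ofAdd 2)⟩ := fun x =>
    (lift_cyclicThreeHom_apply ω hω x).trans (by
      rw [hω2]
      ext <;> simp [ω] <;> ring)
  have h : IsFiberProduct α β (Int.castRingHom (ZMod 3)) residueThree := by
    constructor
    · intro x
      rw [hα, hβ, residueThree_apply, eq_intCast, ZMod.intCast_eq_intCast_iff_dvd_sub]
      exact ⟨-x.coeff (Multiplicative.ofAdd 2), by push_cast; ring⟩
    · intro x h1 h2
      rw [hα] at h1
      rw [hβ] at h2
      have h3 := congrArg QuadraticAlgebra.re h2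
      have h4 := congrArg QuadraticAlgebra.im h2
      simp only [QuadraticAlgebra.re_zero, QuadraticAlgebra.im_zero] at h3 h4
      have key : ∀ g : ZMod 3, x.coeff (Multiplicative.ofAdd g) = 0 := by
        have e0 : x.coeff (Multiplicative.ofAdd 0) = 0 := by omega
        have e1 : x.coeff (Multiplicative.ofAdd 1) = 0 := by omega
        have e2 : x.coeff (Multiplicative.ofAdd 2) = 0 := by omega
        intro g
        fin_cases g
        exacts [e0, e1, e2]
      exact MonoidAlgebra.ext (Finsupp.ext fun g => key (Multiplicative.toAdd g))
    · intro a w haw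
      rw [residueThree_apply, eq_intCast, ZMod.intCast_eq_intCast_iff_dvd_sub] at haw
      obtain ⟨t, ht⟩ := haw
      push_cast at ht
      let x : GroupRingC3 := MonoidAlgebra.ofCoeff (Finsupp.equivFunOnFinite.symm
        fun g => (![w.re - t, w.im - t, -t] : Fin 3 → ℤ) (Multiplicative.toAdd g))
      refine ⟨x, (hα x).trans ?_, (hβ x).trans (QuadraticAlgebra.ext ?_ ?_)⟩
      · change w.re - t + (w.im - t) + -t = a
        linarith
      · change w.re - t - -t = w.re
        ring
      · change w.im - t - -t = w.im
        ring
  exact_mod_cast hasIdealZeta_int.of_isFiberProduct hz h (isPrincipalResidue_int 3)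
    isPrincipalResidue_residueThree

/-! ### Rings of integers -/

/-- If `R` is generated by `t`, then the image of `ψ : R → L` is `ℤ[ψ t]`. -/
theorem mem_adjoin_singleton_iff_exists {R L : Type*} [CommRing R] [CommRing L] (ψ : R →+* L)
    {t : R} (ht : ∀ r, r ∈ Algebra.adjoin ℤ {t}) {x : L} :
    x ∈ Algebra.adjoin ℤ {ψ t} ↔ ∃ r, ψ r = x := by
  have h := AlgHom.map_adjoin_singleton ψ.toIntAlgHom t
  change _ = Algebra.adjoin ℤ {ψ t} at h
  rw [← h, Subalgebra.mem_map]
  exact ⟨fun ⟨r, _, hr⟩ => ⟨r, hr⟩, fun ⟨r, hr⟩ => ⟨r, ht r, hr⟩⟩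

open NumberField in
/-- A ring isomorphic to the ring of integers of `K` has the Dedekind zeta function of `K`. -/
theorem HasIdealZeta.of_isIntegral_iff {R K : Type*} [CommRing R] [Field K] [NumberField K]
    (ψ : R →+* K) (hinj : Function.Injective ψ) (hint : ∀ x : K, IsIntegral ℤ x ↔ ∃ r, ψ r = x) :
    HasIdealZeta R (dedekindZeta K) := by
  let ψ' : R →+* 𝓞 K := ψ.codRestrict (integralClosure ℤ K) fun r => (hint _).mpr ⟨r, rfl⟩
  refine (hasIdealZeta_ringOfIntegers K).of_ringEquiv (RingEquiv.ofBijective ψ' ⟨?_, ?_⟩)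
  · intro r r' h
    exact hinj (congrArg Subtype.val h)
  · rintro ⟨x, hx⟩
    obtain ⟨r, rfl⟩ := (hint x).mp hx
    exact ⟨r, rfl⟩

namespace QuadraticAlgebra

variable {a b : ℤ}

theorem mem_adjoin_omega (z : QuadraticAlgebra ℤ a b) :
    z ∈ Algebra.adjoin ℤ {(⟨0, 1⟩ : QuadraticAlgebra ℤ a b)} := by
  have hz : z = (z.re : QuadraticAlgebra ℤ a b) + z.im • (⟨0, 1⟩ : QuadraticAlgebra ℤ a b) := by
    ext <;> simp
  rw [hz]
  exact add_mem (intCast_mem _ _) (zsmul_mem (Algebra.self_mem_adjoin_singleton ℤ _) _)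

theorem mem_adjoin_iff_exists_homOfRoot {L : Type*} [CommRing L] {θ : L} (hθ : θ * θ = a + b * θ)
    {x : L} : x ∈ Algebra.adjoin ℤ {θ} ↔ ∃ z, homOfRoot θ hθ z = x := by
  have h : homOfRoot θ hθ ⟨0, 1⟩ = θ := by
    rw [homOfRoot_apply]
    simp
  rw [← mem_adjoin_singleton_iff_exists (homOfRoot θ hθ) mem_adjoin_omega, h]

theorem homOfRoot_injective {L : Type*} [CommRing L] {θ : L} (hθ : θ * θ = a + b * θ)
    (h0 : ∀ u v : ℤ, (u + v * θ : L) = 0 → u = 0 ∧ v = 0) :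
    Function.Injective (homOfRoot θ hθ) := by
  rw [injective_iff_map_eq_zero]
  intro z hz
  rw [homOfRoot_apply] at hz
  obtain ⟨h1, h2⟩ := h0 _ _ hz
  exact QuadraticAlgebra.ext h1 h2

end QuadraticAlgebra

/-! ### Real quadratic fields -/

theorem Irrational.eq_zero_of_add_mul_eq_zero {x : ℝ} (hx : Irrational x) {a b : ℚ}
    (h : (a + b * x : ℝ) = 0) : a = 0 ∧ b = 0 := by
  have hb : b = 0 := by
    by_contra hb
    have hb' : (b : ℝ) ≠ 0 := by exact_mod_cast hb
    refine hx ⟨-a / b, ?_⟩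
    push_cast
    field_simp
    linarith
  subst hb
  simpa using h

theorem exists_eq_add_mul_sqrt {d : ℕ} (x : realQuadratic d) :
    ∃ a b : ℚ, (x : ℝ) = a + b * Real.sqrt d := by
  have hint : IsIntegral ℚ (Real.sqrt d) := by
    refine IsIntegral.of_pow (n := 2) two_pos ?_
    rw [Real.sq_sqrt (Nat.cast_nonneg d)]
    exact isIntegral_algebraMap (R := ℚ) (A := ℝ) (x := (d : ℚ))
  have hx : (x : ℝ) ∈ Algebra.adjoin ℚ {Real.sqrt d} := by
    rw [← IntermediateField.adjoin_simple_toSubalgebra_of_isAlgebraic hint.isAlgebraic]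
    exact x.2
  have hd : Real.sqrt d * Real.sqrt d = d := Real.mul_self_sqrt (Nat.cast_nonneg d)
  generalize (x : ℝ) = y at hx
  induction hx using Algebra.adjoin_induction with
  | mem y hy =>
    rw [Set.mem_singleton_iff] at hy
    exact ⟨0, 1, by simp [hy]⟩
  | algebraMap r => exact ⟨r, 0, by simp⟩
  | add y z _ _ hy hz =>
    obtain ⟨a, b, rfl⟩ := hy
    obtain ⟨a', b', rfl⟩ := hz
    exact ⟨a + a', b + b', by push_cast; ring⟩
  | mul y z _ _ hy hz =>
    obtain ⟨a, b, rfl⟩ := hy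
    obtain ⟨a', b', rfl⟩ := hz
    exact ⟨a * a' + d * (b * b'), a * b' + b * a', by
      push_cast; linear_combination (b * b' : ℝ) * hd⟩

theorem exists_int_eq_of_isIntegral_ratCast {q : ℚ} (h : IsIntegral ℤ (q : ℝ)) :
    ∃ m : ℤ, (m : ℚ) = q := by
  have h1 : IsIntegral ℤ q := (isIntegral_algebraMap_iff (algebraMap ℚ ℝ).injective).mp h
  exact IsIntegrallyClosed.isIntegral_iff.mp h1

/-- The conjugate `a - b √d` of an integral element `a + b √d` is integral. -/
theorem isIntegral_sub_mul_sqrt {d : ℕ} (hd : Irrational (Real.sqrt d)) {a b : ℚ}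
    (h : IsIntegral ℤ (a + b * Real.sqrt d : ℝ)) : IsIntegral ℤ (a - b * Real.sqrt d : ℝ) := by
  have hsq : Real.sqrt d * Real.sqrt d = d := Real.mul_self_sqrt (Nat.cast_nonneg d)
  let f : QuadraticAlgebra ℚ d 0 →ₐ[ℚ] ℝ :=
    QuadraticAlgebra.lift ⟨Real.sqrt d, by simp [hsq, Algebra.smul_def]⟩
  let g : QuadraticAlgebra ℚ d 0 →ₐ[ℚ] ℝ :=
    QuadraticAlgebra.lift ⟨-Real.sqrt d, by simp [hsq, Algebra.smul_def]⟩
  have hf : ∀ z, f z = z.re + z.im * Real.sqrt d := fun z => by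
    change z.re • (1 : ℝ) + z.im • Real.sqrt d = _
    simp [Algebra.smul_def]
  have hg : ∀ z, g z = z.re - z.im * Real.sqrt d := fun z => by
    change z.re • (1 : ℝ) + z.im • -Real.sqrt d = _
    simp [Algebra.smul_def, sub_eq_add_neg]
  have hinj : Function.Injective f := by
    rw [injective_iff_map_eq_zero]
    intro z hz
    rw [hf] at hz
    obtain ⟨h1, h2⟩ := hd.eq_zero_of_add_mul_eq_zero hz
    exact QuadraticAlgebra.ext h1 h2
  have hz : IsIntegral ℤ (⟨a, b⟩ : QuadraticAlgebra ℚ d 0) := by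
    refine (isIntegral_algHom_iff f.toRingHom.toIntAlgHom hinj).mp ?_
    change IsIntegral ℤ (f ⟨a, b⟩)
    rwa [hf]
  have := hz.map g.toRingHom.toIntAlgHom
  change IsIntegral ℤ (g ⟨a, b⟩) at this
  rwa [hg] at this

/-- Twice an integral element of `ℚ(√d)` is `m + k √d` with integers `m`, `k` and
`m² ≡ d k² mod 4`. -/
theorem exists_int_of_isIntegral {d : ℕ} (hd : d.Prime) {x : realQuadratic d}
    (hx : IsIntegral ℤ x) :
    ∃ m k n : ℤ, (2 * x : ℝ) = m + k * Real.sqrt d ∧ m ^ 2 - d * k ^ 2 = 4 * n := by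
  have hx' : IsIntegral ℤ (x : ℝ) :=
    hx.map (realQuadratic d).val.toRingHom.toIntAlgHom
  obtain ⟨a, b, hab⟩ := exists_eq_add_mul_sqrt x
  rw [hab] at hx'
  have hconj := isIntegral_sub_mul_sqrt hd.irrational_sqrt hx'
  have hsq : Real.sqrt d * Real.sqrt d = d := Real.mul_self_sqrt (Nat.cast_nonneg d)
  obtain ⟨m, hm⟩ : ∃ m : ℤ, (m : ℚ) = 2 * a := by
    refine exists_int_eq_of_isIntegral_ratCast ?_
    have : ((2 * a : ℚ) : ℝ) = a + b * Real.sqrt d + (a - b * Real.sqrt d) := by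
      push_cast
      ring
    exact this ▸ hx'.add hconj
  obtain ⟨n, hn⟩ : ∃ n : ℤ, (n : ℚ) = a ^ 2 - d * b ^ 2 := by
    refine exists_int_eq_of_isIntegral_ratCast ?_
    have : ((a ^ 2 - d * b ^ 2 : ℚ) : ℝ) =
        (a + b * Real.sqrt d) * (a - b * Real.sqrt d) := by
      push_cast
      linear_combination (b : ℝ) ^ 2 * hsq
    exact this ▸ hx'.mul hconj
  -- `d (2 b)` has an integral square, so it is an integer, divisible by the prime `d`.
  obtain ⟨t, ht⟩ : ∃ t : ℤ, (t : ℚ) = d * (2 * b) := by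
    refine exists_int_eq_of_isIntegral_ratCast (IsIntegral.of_pow (n := 2) two_pos ?_)
    have : (((d * (2 * b) : ℚ) : ℝ)) ^ 2 = ((d * (m ^ 2 - 4 * n) : ℤ) : ℝ) := by
      have : (d * (2 * b) : ℚ) ^ 2 = ((d * (m ^ 2 - 4 * n) : ℤ) : ℚ) := by
        push_cast
        rw [hm, hn]
        ring
      exact_mod_cast this
    rw [this]
    exact isIntegral_algebraMap (R := ℤ) (A := ℝ)
  have hd0 : (d : ℚ) ≠ 0 := Nat.cast_ne_zero.mpr hd.ne_zero
  have htd : (d : ℤ) ∣ t := by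
    refine (Nat.prime_iff_prime_int.mp hd).dvd_of_dvd_pow (n := 2) ⟨m ^ 2 - 4 * n, ?_⟩
    have : (t : ℚ) ^ 2 = d * (m ^ 2 - 4 * n) := by
      rw [ht, hm, hn]
      ring
    exact_mod_cast this
  obtain ⟨k, rfl⟩ := htd
  have hk : (k : ℚ) = 2 * b := by
    push_cast at ht
    exact mul_left_cancel₀ hd0 ht
  refine ⟨m, k, n, ?_, ?_⟩
  · have hmR : (m : ℝ) = 2 * a := by exact_mod_cast congrArg (Rat.cast : ℚ → ℝ) hm
    have hkR : (k : ℝ) = 2 * b := by exact_mod_cast congrArg (Rat.cast : ℚ → ℝ) hk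
    rw [hab, hmR, hkR]
    ring
  · have : (m : ℚ) ^ 2 - d * k ^ 2 = 4 * n := by
      rw [hm, hn, hk]
      ring
    exact_mod_cast this

theorem isIntegral_of_coe_mem_adjoin {d : ℕ} {θ : ℝ} (hθ : IsIntegral ℤ θ) {x : realQuadratic d}
    (hx : (x : ℝ) ∈ Algebra.adjoin ℤ {θ}) : IsIntegral ℤ x := by
  have h1 : IsIntegral ℤ (x : ℝ) := adjoin_le_integralClosure hθ hx
  exact (isIntegral_algHom_iff (realQuadratic d).val.toRingHom.toIntAlgHom
    (realQuadratic d).val.injective).mp h1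

theorem isIntegral_iff_mem_adjoin_sqrt {d : ℕ} (hd : d.Prime) (hmod : d % 4 = 2 ∨ d % 4 = 3)
    (x : realQuadratic d) : IsIntegral ℤ x ↔ (x : ℝ) ∈ Algebra.adjoin ℤ {Real.sqrt d} := by
  have hsq : Real.sqrt d * Real.sqrt d = d := Real.mul_self_sqrt (Nat.cast_nonneg d)
  constructor
  · intro hx
    obtain ⟨m, k, n, h1, h2⟩ := exists_int_of_isIntegral hd hx
    -- Squares are `0` or `1` modulo `4`.
    have hpar : 2 ∣ m ∧ 2 ∣ k := by
      obtain ⟨e, he⟩ : ∃ e : ℤ, (d : ℤ) = 4 * e + 2 ∨ (d : ℤ) = 4 * e + 3 :=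
        ⟨d / 4, by omega⟩
      obtain ⟨i, rfl | rfl⟩ := Int.even_or_odd' m <;>
        obtain ⟨j, rfl | rfl⟩ := Int.even_or_odd' k <;>
        rcases he with he | he <;> rw [he] at h2 <;> ring_nf at h2 <;> omega
    obtain ⟨⟨u, rfl⟩, ⟨v, rfl⟩⟩ := hpar
    have : (x : ℝ) = u + v • Real.sqrt d := by
      push_cast at h1
      rw [zsmul_eq_mul]
      linarith
    rw [this]
    exact add_mem (intCast_mem _ _) (zsmul_mem (Algebra.self_mem_adjoin_singleton ℤ _) _)
  · refine isIntegral_of_coe_mem_adjoin (IsIntegral.of_pow (n := 2) two_pos ?_)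
    rw [sq, hsq]
    exact isIntegral_algebraMap (R := ℤ) (A := ℝ) (x := (d : ℤ))

theorem isIntegral_iff_mem_adjoin_golden (x : realQuadratic 5) :
    IsIntegral ℤ x ↔ (x : ℝ) ∈ Algebra.adjoin ℤ {(1 + Real.sqrt 5) / 2} := by
  constructor
  · intro hx
    obtain ⟨m, k, n, h1, h2⟩ := exists_int_of_isIntegral Nat.prime_five hx
    have hpar : 2 ∣ m - k := by
      push_cast at h2
      obtain ⟨i, rfl | rfl⟩ := Int.even_or_odd' m <;>
        obtain ⟨j, rfl | rfl⟩ := Int.even_or_odd' k <;>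
        ring_nf at h2 <;> omega
    obtain ⟨u, hu⟩ := hpar
    obtain rfl : m = 2 * u + k := by linarith
    have : (x : ℝ) = u + k • ((1 + Real.sqrt 5) / 2) := by
      push_cast at h1
      rw [zsmul_eq_mul]
      linarith
    rw [this]
    exact add_mem (intCast_mem _ _) (zsmul_mem (Algebra.self_mem_adjoin_singleton ℤ _) _)
  · refine isIntegral_of_coe_mem_adjoin ?_
    refine ⟨Polynomial.X ^ 2 - Polynomial.X - 1, by monicity!, ?_⟩
    simp

/-- If the ring of integers of `ℚ(√d)` is `ℤ[θ]` with `θ² = a + b θ`, then `ℤ[ω]`, `ω² = a + b ω`,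
has the Dedekind zeta function of `ℚ(√d)`. -/
theorem hasIdealZeta_realQuadratic {d : ℕ} (hd : Irrational (Real.sqrt d)) {a b : ℤ}
    (θ : realQuadratic d) (hθ : θ * θ = a + b * θ) {u v : ℚ} (huv : (θ : ℝ) = u + v * Real.sqrt d)
    (hv : v ≠ 0)
    (hint : ∀ x : realQuadratic d, IsIntegral ℤ x ↔ (x : ℝ) ∈ Algebra.adjoin ℤ {(θ : ℝ)}) :
    HasIdealZeta (QuadraticAlgebra ℤ a b) (NumberField.dedekindZeta (realQuadratic d)) := by
  refine HasIdealZeta.of_isIntegral_iff (QuadraticAlgebra.homOfRoot θ hθ) ?_ ?_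
  · refine QuadraticAlgebra.homOfRoot_injective hθ fun m k hmk => ?_
    have h1 : ((m + k * u : ℚ) + (k * v : ℚ) * Real.sqrt d : ℝ) = 0 := by
      have := congrArg (Subtype.val : realQuadratic d → ℝ) hmk
      push_cast at this
      rw [huv] at this
      push_cast
      linear_combination this
    obtain ⟨h2, h3⟩ := hd.eq_zero_of_add_mul_eq_zero h1
    have hk : (k : ℚ) = 0 := (mul_eq_zero.mp h3).resolve_right hv
    rw [hk, zero_mul, add_zero] at h2
    exact ⟨by exact_mod_cast h2, by exact_mod_cast hk⟩
  · intro x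
    rw [hint]
    have hθ' : (θ : ℝ) * θ = a + b * θ := by
      have := congrArg (Subtype.val : realQuadratic d → ℝ) hθ
      push_cast at this
      exact this
    rw [QuadraticAlgebra.mem_adjoin_iff_exists_homOfRoot hθ']
    refine exists_congr fun z => ?_
    rw [QuadraticAlgebra.homOfRoot_apply, QuadraticAlgebra.homOfRoot_apply, ← Subtype.coe_inj]
    push_cast
    rfl

/-! ### Cyclotomic fields -/

/-- Mathlib's instance is stated for the algebra structure of the splitting field, which agrees with
the canonical `ℚ`-algebra structure, but not by unfolding instances alone. -/
instance isCyclotomicExtension_rat (n : ℕ) [NeZero n] :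
    IsCyclotomicExtension {n} ℚ (CyclotomicField n ℚ) := by
  have h : DivisionRing.toRatAlgebra = CyclotomicField.algebra n ℚ := Subsingleton.elim _ _
  rw [h]
  exact CyclotomicField.isCyclotomicExtension n ℚ

theorem isIntegral_iff_mem_adjoin_of_isPrimitiveRoot {K : Type*} [Field K]
    [CharZero K] {p : ℕ} [Fact p.Prime] [IsCyclotomicExtension {p} ℚ K] {ζ : K}
    (hζ : IsPrimitiveRoot ζ p) (x : K) :
    IsIntegral ℤ x ↔ x ∈ Algebra.adjoin ℤ {ζ} := by
  have := IsCyclotomicExtension.Rat.isIntegralClosure_adjoin_singleton_of_prime hζ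
  rw [this.isIntegral_iff]
  exact ⟨fun ⟨y, hy⟩ => hy ▸ y.2, fun hx => ⟨⟨x, hx⟩, rfl⟩⟩

theorem hasIdealZeta_cyclotomicThree (K : Type*) [Field K] [NumberField K]
    [IsCyclotomicExtension {3} ℚ K] :
    HasIdealZeta (QuadraticAlgebra ℤ (-1) (-1))
      (NumberField.dedekindZeta K) := by
  have hζ := IsCyclotomicExtension.zeta_spec 3 ℚ K
  set ζ := IsCyclotomicExtension.zeta 3 ℚ K
  have hsum : 1 + ζ + ζ ^ 2 = 0 := by
    have := hζ.geom_sum_eq_zero (by norm_num)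
    simpa [Finset.sum_range_succ] using this
  have hsq : ζ * ζ = ((-1 : ℤ) : K) + ((-1 : ℤ) : K) * ζ := by
    push_cast
    linear_combination hsum
  refine HasIdealZeta.of_isIntegral_iff (QuadraticAlgebra.homOfRoot ζ hsq) ?_ fun x => ?_
  · refine QuadraticAlgebra.homOfRoot_injective hsq fun u v huv => ?_
    -- The norm of `u + v ζ` is `u² - u v + v²`, a positive definite form.
    have h1 : ((u ^ 2 - u * v + v ^ 2 : ℤ) : K) = 0 := by
      push_cast
      linear_combination (u - v - v * ζ : K) * huv +
        (v ^ 2 : K) * hsum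
    have h2 : u ^ 2 - u * v + v ^ 2 = 0 := by exact_mod_cast h1
    have hu : u = 0 := by
      have : u ^ 2 = 0 := by nlinarith [sq_nonneg (u - 2 * v), sq_nonneg u]
      exact pow_eq_zero_iff two_ne_zero |>.mp this
    have hv : v = 0 := by
      subst hu
      simpa using h2
    exact ⟨hu, hv⟩
  · rw [isIntegral_iff_mem_adjoin_of_isPrimitiveRoot hζ,
      QuadraticAlgebra.mem_adjoin_iff_exists_homOfRoot hsq]

/-! ### The maximal real subfield of the seventh cyclotomic field -/

instance fact_prime_seven : Fact (Nat.Prime 7) := ⟨by norm_num⟩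

section Seven

open NumberField

variable {K : Type*} [Field K] {ζ : K} (hζ : IsPrimitiveRoot ζ 7)

include hζ

theorem seven_sum_eq_zero : 1 + ζ + ζ ^ 2 + ζ ^ 3 + ζ ^ 4 + ζ ^ 5 + ζ ^ 6 = 0 := by
  have := hζ.geom_sum_eq_zero (by norm_num)
  simpa [Finset.sum_range_succ] using this

theorem seven_star_embedding (φ : K →+* ℂ) : star (φ ζ) = φ ζ ^ 6 := by
  have h1 : φ ζ ^ 7 = 1 := by rw [← map_pow, hζ.pow_eq_one, map_one]
  have h2 : ‖φ ζ‖ = 1 := (hζ.map_of_injective φ.injective).norm'_eq_one (by norm_num)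
  have h3 : φ ζ ≠ 0 := by
    rw [← norm_ne_zero_iff, h2]
    exact one_ne_zero
  rw [RCLike.star_def, ← Complex.inv_eq_conj h2]
  field_simp
  exact h1.symm

/-- The basis of `ℤ[ζ₇]⁺` which multiplies by the fusion rules: `b = -ζ² - ζ⁵` and
`d = -ζ - ζ² - ζ⁵ - ζ⁶`. -/
noncomputable def psu5Hom : psu5.FusionRing →+* K :=
  psu5.liftHom ![1, -ζ ^ 2 - ζ ^ 5, -ζ - ζ ^ 2 - ζ ^ 5 - ζ ^ 6] (Matrix.cons_val_zero _ _) (by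
    have h := seven_sum_eq_zero hζ
    have h7 := hζ.pow_eq_one
    intro i j
    fin_cases i <;> fin_cases j <;> simp [Fin.sum_univ_three, psu5]
    · linear_combination h + (2 + ζ ^ 3) * h7
    · linear_combination 2 * h + (2 + ζ + ζ ^ 3 + ζ ^ 4) * h7
    · linear_combination 2 * h + (2 + ζ + ζ ^ 3 + ζ ^ 4) * h7
    · linear_combination 3 * h + (4 + 2 * ζ + ζ ^ 3 + 2 * ζ ^ 4 + ζ ^ 5) * h7)

theorem psu5Hom_apply (x : psu5.FusionRing) :
    psu5Hom hζ x = x 0 + x 1 * (-ζ ^ 2 - ζ ^ 5) + x 2 * (-ζ - ζ ^ 2 - ζ ^ 5 - ζ ^ 6) := by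
  refine (psu5.liftHom_apply _ _ _ x).trans ?_
  rw [Fin.sum_univ_three]
  simp

theorem psu5Hom_mem_real (x : psu5.FusionRing) : psu5Hom hζ x ∈ (maximalRealSubfield K) := by
  have hb : -ζ ^ 2 - ζ ^ 5 ∈ (maximalRealSubfield K) := by
    intro φ
    have h7 : φ ζ ^ 7 = 1 := by rw [← map_pow, hζ.pow_eq_one, map_one]
    simp only [map_sub, map_neg, map_pow, star_sub, star_neg, star_pow, seven_star_embedding hζ φ]
    set w := φ ζ
    linear_combination (-w ^ 5 - w ^ 2 * (w ^ 21 + w ^ 14 + w ^ 7 + 1)) * h7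
  have hd : -ζ - ζ ^ 2 - ζ ^ 5 - ζ ^ 6 ∈ (maximalRealSubfield K) := by
    intro φ
    have h7 : φ ζ ^ 7 = 1 := by rw [← map_pow, hζ.pow_eq_one, map_one]
    simp only [map_sub, map_neg, map_pow, star_sub, star_neg, star_pow, seven_star_embedding hζ φ]
    set w := φ ζ
    linear_combination (-w ^ 5 - w ^ 2 * (w ^ 21 + w ^ 14 + w ^ 7 + 1) -
      w * (w ^ 28 + w ^ 21 + w ^ 14 + w ^ 7 + 1)) * h7
  rw [psu5Hom_apply]
  exact add_mem (add_mem (intCast_mem _ _) (mul_mem (intCast_mem _ _) hb))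
    (mul_mem (intCast_mem _ _) hd)

variable [NumberField K]

theorem seven_natDegree_minpoly : (minpoly ℚ ζ).natDegree = 6 := by
  rw [← Polynomial.cyclotomic_eq_minpoly_rat hζ (by norm_num), Polynomial.natDegree_cyclotomic]
  decide

theorem seven_linearIndependent {c₀ c₁ c₂ c₃ c₄ c₅ : ℤ}
    (h : (c₀ + c₁ * ζ + c₂ * ζ ^ 2 + c₃ * ζ ^ 3 + c₄ * ζ ^ 4 + c₅ * ζ ^ 5 : K) = 0) :
    c₀ = 0 ∧ c₁ = 0 ∧ c₂ = 0 ∧ c₃ = 0 ∧ c₄ = 0 ∧ c₅ = 0 := by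
  have hli : LinearIndependent ℚ fun i : Fin 6 => ζ ^ (i : ℕ) :=
    seven_natDegree_minpoly hζ ▸ linearIndependent_pow ζ
  rw [Fintype.linearIndependent_iff] at hli
  have := hli ![c₀, c₁, c₂, c₃, c₄, c₅] (by
    rw [Fin.sum_univ_six]
    simpa [Algebra.smul_def] using h)
  refine ⟨?_, ?_, ?_, ?_, ?_, ?_⟩
  · simpa using this 0
  · simpa using this 1
  · simpa using this 2
  · simpa using this 3
  · simpa using this 4
  · simpa using this 5

theorem psu5Hom_injective : Function.Injective (psu5Hom hζ) := by
  rw [injective_iff_map_eq_zero]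
  intro x hx
  rw [psu5Hom_apply] at hx
  -- Rewritten in `1, ζ, …, ζ⁵` by means of `ζ⁶ = -1 - ζ - ⋯ - ζ⁵`.
  have h1 : (((x 0 + x 2 : ℤ) : K) + ((0 : ℤ) : K) * ζ + ((-x 1 : ℤ) : K) * ζ ^ 2 +
      ((x 2 : ℤ) : K) * ζ ^ 3 + ((x 2 : ℤ) : K) * ζ ^ 4 + ((-x 1 : ℤ) : K) * ζ ^ 5) = 0 := by
    push_cast
    linear_combination hx + (x 2 : K) * seven_sum_eq_zero hζ
  obtain ⟨e0, -, e1, e2, -, -⟩ := seven_linearIndependent hζ h1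
  funext i
  change x i = 0
  fin_cases i
  · change x 0 = 0
    omega
  · change x 1 = 0
    omega
  · exact e2

variable [IsCyclotomicExtension {7} ℚ K]

theorem seven_exists_coeff {x : K} (hx : IsIntegral ℤ x) :
    ∃ c₀ c₁ c₂ c₃ c₄ c₅ : ℤ,
      x = c₀ + c₁ * ζ + c₂ * ζ ^ 2 + c₃ * ζ ^ 3 + c₄ * ζ ^ 4 + c₅ * ζ ^ 5 := by
  rw [isIntegral_iff_mem_adjoin_of_isPrimitiveRoot hζ,
    Algebra.adjoin_singleton_eq_range_aeval] at hx
  obtain ⟨P, rfl⟩ := hx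
  have hmonic := Polynomial.cyclotomic.monic 7 ℤ
  have hroot : Polynomial.aeval ζ (Polynomial.cyclotomic 7 ℤ) = 0 := by
    rw [Polynomial.aeval_def, ← Polynomial.eval_map, Polynomial.map_cyclotomic]
    exact hζ.isRoot_cyclotomic (by norm_num)
  set Q := P %ₘ Polynomial.cyclotomic 7 ℤ with hQ
  have hPQ : Polynomial.aeval ζ P = Polynomial.aeval ζ Q :=
    (Polynomial.aeval_modByMonic_eq_self_of_root hroot).symm
  have hdeg : Q.natDegree < 6 := by
    have h1 := Polynomial.natDegree_modByMonic_lt P hmonic (by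
      intro h
      have := congrArg Polynomial.natDegree h
      rw [Polynomial.natDegree_cyclotomic, Polynomial.natDegree_one] at this
      exact absurd this (by decide))
    rwa [Polynomial.natDegree_cyclotomic, show Nat.totient 7 = 6 by decide] at h1
  refine ⟨Q.coeff 0, Q.coeff 1, Q.coeff 2, Q.coeff 3, Q.coeff 4, Q.coeff 5, ?_⟩
  change Polynomial.aeval ζ P = _
  rw [hPQ, Polynomial.aeval_eq_sum_range' hdeg]
  simp [Finset.sum_range_succ, zsmul_eq_mul]

theorem psu5Hom_isIntegral (x : psu5.FusionRing) : IsIntegral ℤ (psu5Hom hζ x) := by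
  rw [isIntegral_iff_mem_adjoin_of_isPrimitiveRoot hζ, psu5Hom_apply]
  have hz : ζ ∈ Algebra.adjoin ℤ {ζ} := Algebra.self_mem_adjoin_singleton ℤ ζ
  have hb : -ζ ^ 2 - ζ ^ 5 ∈ Algebra.adjoin ℤ {ζ} :=
    sub_mem (neg_mem (pow_mem hz 2)) (pow_mem hz 5)
  have hd : -ζ - ζ ^ 2 - ζ ^ 5 - ζ ^ 6 ∈ Algebra.adjoin ℤ {ζ} :=
    sub_mem (sub_mem (sub_mem (neg_mem hz) (pow_mem hz 2)) (pow_mem hz 5)) (pow_mem hz 6)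
  exact add_mem (add_mem (intCast_mem _ _) (mul_mem (intCast_mem _ _) hb))
    (mul_mem (intCast_mem _ _) hd)

/-- An integral element fixed by complex conjugation is an integral combination of the basis:
compare the coordinates of `x` and of its conjugate. -/
theorem exists_psu5Hom_eq {x : K} (hx : x ∈ (maximalRealSubfield K)) (hint : IsIntegral ℤ x) :
    ∃ r, psu5Hom hζ r = x := by
  have h7 := hζ.pow_eq_one
  have hs := seven_sum_eq_zero hζ
  obtain ⟨c₀, c₁, c₂, c₃, c₄, c₅, rfl⟩ := seven_exists_coeff hζ hint
  have hconj : (c₀ + c₁ * ζ + c₂ * ζ ^ 2 + c₃ * ζ ^ 3 + c₄ * ζ ^ 4 + c₅ * ζ ^ 5 : K) =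
      c₀ + c₁ * ζ ^ 6 + c₂ * (ζ ^ 6) ^ 2 + c₃ * (ζ ^ 6) ^ 3 + c₄ * (ζ ^ 6) ^ 4 +
        c₅ * (ζ ^ 6) ^ 5 := by
    obtain ⟨φ⟩ : Nonempty (K →+* ℂ) := inferInstance
    apply φ.injective
    rw [← hx φ]
    simp only [map_add, map_mul, map_intCast, map_pow, star_add, star_mul', star_pow, star_intCast,
      seven_star_embedding hζ φ]
  have h1 : (((c₁ : ℤ) : K) + ((2 * c₁ : ℤ) : K) * ζ + ((c₂ - c₅ + c₁ : ℤ) : K) * ζ ^ 2 +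
      ((c₃ - c₄ + c₁ : ℤ) : K) * ζ ^ 3 + ((c₄ - c₃ + c₁ : ℤ) : K) * ζ ^ 4 +
      ((c₅ - c₂ + c₁ : ℤ) : K) * ζ ^ 5) = 0 := by
    push_cast
    linear_combination hconj + (c₁ : K) * hs + (c₂ * ζ ^ 5 + c₃ * ζ ^ 4 * (ζ ^ 7 + 1) +
      c₄ * ζ ^ 3 * (ζ ^ 14 + ζ ^ 7 + 1) + c₅ * ζ ^ 2 * (ζ ^ 21 + ζ ^ 14 + ζ ^ 7 + 1)) * h7
  obtain ⟨e1, -, e2, e3, -, -⟩ := seven_linearIndependent hζ h1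
  obtain rfl : c₁ = 0 := e1
  obtain rfl : c₅ = c₂ := by omega
  obtain rfl : c₄ = c₃ := by omega
  let r : psu5.FusionRing := (![c₀ - c₄, -c₅, c₄] : Fin 3 → ℤ)
  refine ⟨r, (psu5Hom_apply hζ r).trans ?_⟩
  change ((c₀ - c₄ : ℤ) : K) + ((-c₅ : ℤ) : K) * (-ζ ^ 2 - ζ ^ 5) +
    ((c₄ : ℤ) : K) * (-ζ - ζ ^ 2 - ζ ^ 5 - ζ ^ 6) = _
  push_cast
  linear_combination (-(c₄ : K)) * hs

theorem isIntegral_coe_iff_exists_psu5Hom (x : (maximalRealSubfield K)) :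
    IsIntegral ℤ x ↔ ∃ r, psu5Hom hζ r = x := by
  have hcoe : IsIntegral ℤ x ↔ IsIntegral ℤ (x : K) :=
    (isIntegral_algHom_iff (maximalRealSubfield K).subtype.toIntAlgHom Subtype.val_injective).symm
  rw [hcoe]
  constructor
  · exact exists_psu5Hom_eq hζ x.2
  · rintro ⟨r, hr⟩
    exact hr ▸ psu5Hom_isIntegral hζ r

theorem isIntegral_maximalRealSubfield_iff (x : (maximalRealSubfield K)) :
    IsIntegral ℤ x ↔ (x : K) ∈ Algebra.adjoin ℤ {-ζ - ζ ^ 2 - ζ ^ 5 - ζ ^ 6} := by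
  let d : psu5.FusionRing := (![0, 0, 1] : Fin 3 → ℤ)
  have hd : psu5Hom hζ d = -ζ - ζ ^ 2 - ζ ^ 5 - ζ ^ 6 := by
    rw [psu5Hom_apply]
    change ((0 : ℤ) : K) + ((0 : ℤ) : K) * (-ζ ^ 2 - ζ ^ 5) +
      ((1 : ℤ) : K) * (-ζ - ζ ^ 2 - ζ ^ 5 - ζ ^ 6) = _
    push_cast
    ring
  -- The fusion ring is generated by `d`, because `b = d² - d - 1`.
  have hgen : ∀ r, r ∈ Algebra.adjoin ℤ {d} := by
    intro r
    have hr : r = ((r 0 : ℤ) : psu5.FusionRing) + ((r 1 : ℤ) : psu5.FusionRing) * (d * d - d - 1) +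
        ((r 2 : ℤ) : psu5.FusionRing) * d := by
      apply psu5Hom_injective hζ
      simp only [map_add, map_mul, map_sub, map_one, map_intCast]
      rw [hd, psu5Hom_apply]
      have h7 := hζ.pow_eq_one
      have hs := seven_sum_eq_zero hζ
      linear_combination (-(r 1 : K)) * (3 * hs + (4 + 2 * ζ + ζ ^ 3 + 2 * ζ ^ 4 + ζ ^ 5) * h7)
    have hdm : d ∈ Algebra.adjoin ℤ {d} := Algebra.self_mem_adjoin_singleton ℤ d
    rw [hr]
    exact add_mem (add_mem (intCast_mem _ _) (mul_mem (intCast_mem _ _)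
      (sub_mem (sub_mem (mul_mem hdm hdm) hdm) (one_mem _)))) (mul_mem (intCast_mem _ _) hdm)
  rw [isIntegral_coe_iff_exists_psu5Hom hζ, ← hd]
  exact (mem_adjoin_singleton_iff_exists (psu5Hom hζ) hgen).symm

end Seven

open NumberField in
theorem hasIdealZeta_psu5 (K : Type*) [Field K] [NumberField K] [IsCyclotomicExtension {7} ℚ K] :
    HasIdealZeta psu5.FusionRing (NumberField.dedekindZeta (maximalRealSubfield K)) := by
  have hζ := IsCyclotomicExtension.zeta_spec 7 ℚ K
  refine HasIdealZeta.of_isIntegral_iff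
    ((psu5Hom hζ).codRestrict (maximalRealSubfield K) (psu5Hom_mem_real hζ)) ?_ fun x => ?_
  · intro r r' h
    exact psu5Hom_injective hζ (congrArg Subtype.val h)
  · rw [isIntegral_coe_iff_exists_psu5Hom hζ]
    exact exists_congr fun r =>
      (Subtype.ext_iff (a1 := (psu5Hom hζ).codRestrict _ (psu5Hom_mem_real hζ) r)).symm

/-! ### The Fibonacci ring and the three quadratic orders -/

theorem hasIdealZeta_fibonacci {z : ℂ → ℂ} (hz : HasIdealZeta (QuadraticAlgebra ℤ 1 1) z) :
    HasIdealZeta fibonacci.FusionRing z := by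
  let ψ : fibonacci.FusionRing →+* QuadraticAlgebra ℤ 1 1 :=
    fibonacci.liftHom ![1, ⟨0, 1⟩] (Matrix.cons_val_zero _ _) (by
      intro i j
      fin_cases i <;> fin_cases j <;> ext <;>
        simp [fibonacci, QuadraticAlgebra.re_one, QuadraticAlgebra.im_one])
  have hψ : ∀ x, ψ x = ⟨x 0, x 1⟩ := fun x => by
    refine (fibonacci.liftHom_apply _ _ _ x).trans ?_
    rw [Fin.sum_univ_two]
    ext <;> simp
  refine hz.of_ringEquiv (RingEquiv.ofBijective ψ ⟨?_, fun z => ?_⟩)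
  · rw [injective_iff_map_eq_zero]
    intro x hx
    rw [hψ] at hx
    funext i
    fin_cases i
    · exact congrArg QuadraticAlgebra.re hx
    · exact congrArg QuadraticAlgebra.im hx
  · exact ⟨(![z.re, z.im] : Fin 2 → ℤ), hψ _⟩

theorem sqrt_mem_realQuadratic (d : ℕ) : Real.sqrt d ∈ realQuadratic d :=
  IntermediateField.mem_adjoin_simple_self ℚ _

theorem Algebra.adjoin_singleton_one_add {L : Type*} [CommRing L] (x : L) :
    Algebra.adjoin ℤ {1 + x} = Algebra.adjoin ℤ {x} := by
  refine le_antisymm (Algebra.adjoin_le ?_) (Algebra.adjoin_le ?_)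
  · rw [Set.singleton_subset_iff]
    exact add_mem (one_mem _) (Algebra.self_mem_adjoin_singleton ℤ x)
  · rw [Set.singleton_subset_iff]
    have := sub_mem (Algebra.self_mem_adjoin_singleton ℤ (1 + x)) (one_mem _)
    rwa [add_sub_cancel_left] at this

theorem hasIdealZeta_realQuadratic_five :
    HasIdealZeta (QuadraticAlgebra ℤ 1 1) (NumberField.dedekindZeta (realQuadratic 5)) := by
  have hsq : Real.sqrt (5 : ℕ) * Real.sqrt (5 : ℕ) = 5 := Real.mul_self_sqrt (by norm_num)
  have hmem : (1 + Real.sqrt (5 : ℕ)) / 2 ∈ realQuadratic 5 :=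
    div_mem (add_mem (one_mem _) (sqrt_mem_realQuadratic 5)) (ofNat_mem _ 2)
  refine hasIdealZeta_realQuadratic Nat.prime_five.irrational_sqrt ⟨_, hmem⟩ ?_ (u := 1 / 2)
    (v := 1 / 2) ?_ (by norm_num) ?_
  · refine Subtype.ext ?_
    push_cast
    push_cast at hsq
    linear_combination hsq / 4
  · push_cast
    ring
  · intro x
    rw [isIntegral_iff_mem_adjoin_golden]
    norm_num

theorem hasIdealZeta_realQuadratic_two :
    HasIdealZeta (QuadraticAlgebra ℤ 2 0) (NumberField.dedekindZeta (realQuadratic 2)) := by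
  have hsq : Real.sqrt (2 : ℕ) * Real.sqrt (2 : ℕ) = 2 := Real.mul_self_sqrt (by norm_num)
  refine hasIdealZeta_realQuadratic Nat.prime_two.irrational_sqrt ⟨_, sqrt_mem_realQuadratic 2⟩ ?_
    (u := 0) (v := 1) ?_ (by norm_num)
    (isIntegral_iff_mem_adjoin_sqrt Nat.prime_two (Or.inl rfl))
  · refine Subtype.ext ?_
    change Real.sqrt (2 : ℕ) * Real.sqrt (2 : ℕ) =
      ((2 : ℤ) : ℝ) + ((0 : ℤ) : ℝ) * Real.sqrt (2 : ℕ)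
    rw [hsq]
    norm_num
  · push_cast
    ring

/-- The ring `ℤ[√3]`, generated by `1 + √3`, a root of `X² - 2 X - 2`. -/
theorem hasIdealZeta_realQuadratic_three :
    HasIdealZeta (QuadraticAlgebra ℤ 2 2) (NumberField.dedekindZeta (realQuadratic 3)) := by
  have hsq : Real.sqrt (3 : ℕ) * Real.sqrt (3 : ℕ) = 3 := Real.mul_self_sqrt (by norm_num)
  refine hasIdealZeta_realQuadratic Nat.prime_three.irrational_sqrt
    ⟨_, add_mem (one_mem _) (sqrt_mem_realQuadratic 3)⟩ ?_ (u := 1) (v := 1) ?_ (by norm_num) ?_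
  · refine Subtype.ext ?_
    change (1 + Real.sqrt (3 : ℕ)) * (1 + Real.sqrt (3 : ℕ)) =
      ((2 : ℤ) : ℝ) + ((2 : ℤ) : ℝ) * (1 + Real.sqrt (3 : ℕ))
    push_cast
    push_cast at hsq
    linear_combination hsq
  · push_cast
    ring
  · intro x
    rw [isIntegral_iff_mem_adjoin_sqrt Nat.prime_three (Or.inr rfl),
      Algebra.adjoin_singleton_one_add]

theorem mainTheorem5 :
    -- the Fibonacci ring; the ring of integers of `ℚ(√5)` is `ℤ[(1 + √5) / 2]`
    ((∀ x : realQuadratic 5, IsIntegral ℤ x ↔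
        (x : ℝ) ∈ Algebra.adjoin ℤ {(1 + Real.sqrt 5) / 2}) ∧
      ZetaIs fibonacci.FusionRing fun s => NumberField.dedekindZeta (realQuadratic 5) s) ∧
    -- the Ising ring; the ring of integers of `ℚ(√2)` is `ℤ[√2]`
    ((∀ x : realQuadratic 2, IsIntegral ℤ x ↔ (x : ℝ) ∈ Algebra.adjoin ℤ {Real.sqrt 2}) ∧
      ZetaIs ising.FusionRing fun s => ((2 : ℂ) ^ (1 - 2 * s) - (2 : ℂ) ^ (-s) + 1) *
        riemannZeta s * NumberField.dedekindZeta (realQuadratic 2) s) ∧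
    -- `Rep(S₃)`
    (ZetaIs repS3.FusionRing fun s => ((2 : ℂ) ^ (1 - 2 * s) - (2 : ℂ) ^ (-s) + 1) *
        ((3 : ℂ) ^ (1 - 2 * s) - (3 : ℂ) ^ (-s) + 1) * riemannZeta s ^ 3) ∧
    -- `PSU(5)₂`; the ring of integers of `ℚ(ζ₇)⁺` is `ℤ[α]`, `α = -ζ₇ - ζ₇² - ζ₇⁵ - ζ₇⁶`
    ((∀ ζ : CyclotomicField 7 ℚ, IsPrimitiveRoot ζ 7 →
        ∀ x : realCyclotomicSeven, IsIntegral ℤ x ↔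
          (x : CyclotomicField 7 ℚ) ∈ Algebra.adjoin ℤ {-ζ - ζ ^ 2 - ζ ^ 5 - ζ ^ 6}) ∧
      ZetaIs psu5.FusionRing fun s => NumberField.dedekindZeta realCyclotomicSeven s) ∧
    -- the `E₆`-subfactor ring; the ring of integers of `ℚ(√3)` is `ℤ[√3]`
    ((∀ x : realQuadratic 3, IsIntegral ℤ x ↔ (x : ℝ) ∈ Algebra.adjoin ℤ {Real.sqrt 3}) ∧
      ZetaIs e6.FusionRing fun s => ((2 : ℂ) ^ (1 - 2 * s) - (2 : ℂ) ^ (-s) + 1) *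
        riemannZeta s * NumberField.dedekindZeta (realQuadratic 3) s) ∧
    -- the cyclic group `C₃`; the ring of integers of `ℚ(ζ₃) = ℚ(√-3)` is `ℤ[ζ₃]`
    ((∀ ζ : CyclotomicField 3 ℚ, IsPrimitiveRoot ζ 3 →
        ∀ x : CyclotomicField 3 ℚ, IsIntegral ℤ x ↔ x ∈ Algebra.adjoin ℤ {ζ}) ∧
      ZetaIs GroupRingC3 fun s => ((3 : ℂ) ^ (1 - 2 * s) - (3 : ℂ) ^ (-s) + 1) *
        riemannZeta s * NumberField.dedekindZeta (CyclotomicField 3 ℚ) s) := by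

  refine ⟨⟨isIntegral_iff_mem_adjoin_golden,
    (hasIdealZeta_fibonacci hasIdealZeta_realQuadratic_five).zetaIs⟩, ⟨fun x => ?_, ?_⟩, ?_,
    ⟨fun ζ hζ x => isIntegral_maximalRealSubfield_iff hζ x,
      (hasIdealZeta_psu5 (CyclotomicField 7 ℚ)).zetaIs⟩, ⟨fun x => ?_, ?_⟩,
    ⟨fun ζ hζ x => isIntegral_iff_mem_adjoin_of_isPrimitiveRoot hζ x,
      (hasIdealZeta_groupRingC3 (hasIdealZeta_cyclotomicThree (CyclotomicField 3 ℚ))).zetaIs⟩⟩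
  · exact_mod_cast isIntegral_iff_mem_adjoin_sqrt Nat.prime_two (Or.inl rfl) x
  · exact (hasIdealZeta_of_fusionRules ising 0 rfl rfl hasIdealZeta_realQuadratic_two).zetaIs
  · refine ((hasIdealZeta_of_fusionRules repS3 1 rfl rfl
      hasIdealZeta_quadraticAlgebra_two_one).congr fun s => ?_).zetaIs
    ring
  · exact_mod_cast isIntegral_iff_mem_adjoin_sqrt Nat.prime_three (Or.inr rfl) x
  · exact (hasIdealZeta_of_fusionRules e6 2 rfl rfl hasIdealZeta_realQuadratic_three).zetaIs
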